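/- **Setting.** Let $\mathcal X\subset\mathbb R^n$ be open. The true plant is $\dot x=f(x)+g(x)u$, $u\in\mathbb R^m$, with $f:\mathcal X\to\mathbb R^n$ and $g:\mathcal X\to\mathbb R^{n\times m}$ locally Lipschitz; $\dot x=\tilde f(x)+\tilde g(x)u$ is a nominal model. Let $B:\mathcal X\to\mathbb R$ be $C^1$, $\gamma:\mathbb R\to\mathbb R$, $u_{\rm ref}:\mathcal X\to\mathbb R^m$, $\varepsilon,\tau,\sigma_n>0$ and $\beta_N>0$ for $N\ge 0$ (a constant $\beta$ is a special case). Write $L_fB=\nabla B\cdot f$, $L_gB=\nabla B\cdot g$, similarly $L_{\tilde f}B,L_{\tilde g}B$, and $\Delta_B(x,u)=(L_fB-L_{\tilde f}B)(x)+(L_gB-L_{\tilde g}B)(x)u$. A dataset $\mathbb D$ consists of finitely many triples $(x_j,u_j,z_j)$, $1\le j\le N$, with $x_j\in\mathcal X$, $u_j\in\mathbb R^m$, $z_j\in\mathbb R$. Let $y_j=[1,u_j^T]^T$. Let $k_1,\dots,k_{m+1}$ be symmetric positive semidefinite kernels on $\mathcal X$ with $k_i(x,x)>0$, let $K_c=\big(y_i^T\,\mathrm{Diag}(k_1(x_i,x_j),\dots,k_{m+1}(x_i,x_j))\,y_j\big)_{i,j}$,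 let $K_{*Y}(x)$ be the $(m+1)\times N$ matrix with entries $k_i(x,x_j)(y_j)_i$, and put $$m_B(x|\mathbb D)^T=z^T(K_c+\sigma_n^2I)^{-1}K_{*Y}^T,\qquad \Sigma_B(x|\mathbb D)=\mathrm{Diag}(k_i(x,x))-K_{*Y}(K_c+\sigma_n^2I)^{-1}K_{*Y}^T,$$ $\mu_B(x,u|\mathbb D)=m_B^T[1,u^T]^T$ and $\sigma_B(x,u|\mathbb D)=\big([1,u^T]\Sigma_B[1,u^T]^T\big)^{1/2}$. Let $u^*(x|\mathbb D)$ be the minimizer of $\|u-u_{\rm ref}(x)\|_2^2$ over all $u\in\mathbb R^m$ with $$L_{\tilde f}B(x)+L_{\tilde g}B(x)u+\mu_B(x,u|\mathbb D)-\beta_N\sigma_B(x,u|\mathbb D)+\gamma(B(x))\ge 0 .$$ Let $\widehat{L_gB}(x|\mathbb D)=L_{\tilde g}B(x)+(m_B)_{[2:m+1]}^T$, let $\Sigma_{L_gB}$ be the lower right $m\times m$ block of $\Sigma_B$, let $\lambda_\dagger(x|\mathbb D)$ be the minimum eigenvalue of $\beta_N^2\Sigma_{L_gB}-\widehat{L_gB}^T\widehat{L_gB}$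 and $e_\dagger(x|\mathbb D)$ a unit eigenvector for it (a fixed choice), and let $u_{\rm safe}(x|\mathbb D)=\alpha\,\mathrm{sgn}(\widehat{L_gB}\,e_\dagger)\,e_\dagger$, where $\alpha=\alpha(x,\mathbb D)>0$ is given. **Algorithm.** The control law is $\bar u(x|\mathbb D)=u^*(x|\mathbb D)$ if $\lambda_\dagger(x|\mathbb D)<-\varepsilon$ and $\bar u(x|\mathbb D)=u_{\rm safe}(x|\mathbb D)$ otherwise. An *update* at the state $x$ adds $\big(x,\bar u(x|\mathbb D),\Delta_B(x,\bar u(x|\mathbb D))+\epsilon_N\big)$ to a dataset $\mathbb D$ of $N$ points, where $(\epsilon_N)_{N\ge 0}$ is an arbitrary fixed noise realization. At each time $t$ with $t\bmod\tau=0$ (in particular at $t=0$) one time-triggered update is made (which is also the event-triggered one if $\lambda_\dagger\ge-\varepsilon$ then), and at each time an event-triggered update is made as long as $\lambda_\dagger(x(t)|\mathbb D)\ge-\varepsilon$ for the current dataset; all updates at one time are made instantaneously, so that $\lambda_\dagger<-\varepsilon$ when they end. A *solution on $[0,T)$* from $(x_0,\mathbb D_0)$ is a continuous $x:[0,T)\to\mathcal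 X$ with $x(0)=x_0$, together with a right-continuous, piecewise constant dataset $\mathbb D_{N(t)}$ (with a left limit at each $t\in(0,T)$) which at each time $t$ results from the dataset just before $t$ (from $\mathbb D_0$ if $t=0$) by the finitely many updates, possibly none, that the algorithm makes at time $t$, such that $\dot x(t)=f(x(t))+g(x(t))\,\bar u(x(t)|\mathbb D_{N(t)})$ for all $t\in[0,T)$, where $\dot x$ is the right derivative. **Theorem.** Assume that $L_{\tilde f}B$, $L_{\tilde g}B$, $\gamma\circ B$, $u_{\rm ref}$ and, for each fixed dataset and each $u$, $\mu_B(\cdot,u|\mathbb D)$ and $\sigma_B(\cdot,u|\mathbb D)$ are twice continuously differentiable on $\mathcal X$, and that $L_gB(x)\ne 0$ for all $x\in\mathcal X$. Let $x_0\in\mathcal X$ and let $\mathbb D_0$ be an initial dataset (possibly empty) such that 1. $\lambda_\dagger(x_0|\mathbb D_0)<0$; 2. along every solution from $(x_0,\mathbb D_0)$, $\widehat{L_gB}(x(t)|\mathbb D_{N(t)})\ne 0$ for all $t$; 3. at every event-triggered update, from $\mathbb D$ to $\mathbb D^+$ at a time $t$, along every solution from $(x_0,\mathbb D_0)$, $\widehat{L_gB}(x(t)|\mathbb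 D^+)\,e_\dagger(x(t)|\mathbb D)\ne 0$; 4. only finitely many updates are made at the initial time $t=0$. Then there is a $\tau_{max}>0$ (depending on $x_0$ and $\mathbb D_0$) such that a solution from $(x_0,\mathbb D_0)$ exists on $[0,\tau_{max})$, and it is unique; moreover, for every $T>0$, any two solutions on $[0,T)$ from $(x_0,\mathbb D_0)$ coincide, although the dataset updates can make the control law discontinuous. -/

import Mathlib

open Filter Set
open scoped Topology Matrix

noncomputable section

/-- One noisy measurement `((x_j, u_j), z_j)` of the uncertain term `Δ_B`. -/
structure Sample (n m : ℕ) where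
  x : EuclideanSpace ℝ (Fin n)
  u : EuclideanSpace ℝ (Fin m)
  z : ℝ

/-- A finite dataset `𝔻_N`; the number of points `N` is the length of the list. -/
abbrev Dataset (n m : ℕ) := List (Sample n m)

/-- The objects that enter the safe online learning algorithm (raw data, no properties). -/
structure LearningSetup (n m : ℕ) where
  /-- the state domain -/
  X : Set (EuclideanSpace ℝ (Fin n))
  /-- drift of the true plant -/
  f : EuclideanSpace ℝ (Fin n) → EuclideanSpace ℝ (Fin n)
  /-- input map of the true plant -/
  g : EuclideanSpace ℝ (Fin n) → EuclideanSpace ℝ (Fin m) →L[ℝ] EuclideanSpace ℝ (Fin n)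
  /-- drift of the nominal model -/
  fNom : EuclideanSpace ℝ (Fin n) → EuclideanSpace ℝ (Fin n)
  /-- input map of the nominal model -/
  gNom : EuclideanSpace ℝ (Fin n) → EuclideanSpace ℝ (Fin m) →L[ℝ] EuclideanSpace ℝ (Fin n)
  /-- the barrier function -/
  B : EuclideanSpace ℝ (Fin n) → ℝ
  /-- the comparison function in the barrier condition -/
  γ : ℝ → ℝ
  /-- the reference controller -/
  uRef : EuclideanSpace ℝ (Fin n) → EuclideanSpace ℝ (Fin m)
  /-- the `m + 1` individual kernels of the affine dot product kernel -/
  k : Fin (m + 1) → EuclideanSpace ℝ (Fin n) → EuclideanSpace ℝ (Fin n) → ℝ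
  /-- `σ_n`, the square root of the noise variance used in the regression -/
  σn : ℝ
  /-- the confidence multiplier, which may depend on the number of data points -/
  β : ℕ → ℝ
  /-- the event threshold -/
  ε : ℝ
  /-- the period of the time-triggered measurements -/
  τ : ℝ
  /-- the magnitude of the backup input, which may be chosen from the state and the dataset -/
  α : EuclideanSpace ℝ (Fin n) → Dataset n m → ℝ
  /-- the realization of the measurement noise: `noise N` corrupts the measurement that is
  taken when the dataset has `N` points -/
  noise : ℕ → ℝ

namespace LearningSetup

variable {n m : ℕ} (S : LearningSetup n m)

/-! ### Lie derivatives and the uncertain term -/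

/-- `L_f B(x) = ∇B(x) · f(x)`. -/
def LfB (x : EuclideanSpace ℝ (Fin n)) : ℝ := fderiv ℝ S.B x (S.f x)

/-- The row vector `L_g B(x) = ∇B(x) · g(x)`. -/
def LgB (x : EuclideanSpace ℝ (Fin n)) : Fin m → ℝ :=
  fun j => fderiv ℝ S.B x (S.g x (EuclideanSpace.single j 1))

/-- The Lie derivative of `B` along the nominal drift. -/
def LfNomB (x : EuclideanSpace ℝ (Fin n)) : ℝ := fderiv ℝ S.B x (S.fNom x)

/-- The row vector of Lie derivatives of `B` along the nominal input directions. -/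
def LgNomB (x : EuclideanSpace ℝ (Fin n)) : Fin m → ℝ :=
  fun j => fderiv ℝ S.B x (S.gNom x (EuclideanSpace.single j 1))

/-- `Δ_B(x, u)`, the mismatch between the true and the nominal derivative of `B`. -/
def ΔB (x : EuclideanSpace ℝ (Fin n)) (u : EuclideanSpace ℝ (Fin m)) : ℝ :=
  (S.LfB x - S.LfNomB x) + (S.LgB x - S.LgNomB x) ⬝ᵥ u.ofLp

/-! ### Gaussian process regression with the affine dot product kernel -/

/-- The vector `y = [1, uᵀ]ᵀ`. -/
def aug (u : EuclideanSpace ℝ (Fin m)) : Fin (m + 1) → ℝ := Fin.cons 1 u.ofLp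

/-- The affine dot product compound kernel
`k_c((x, y), (x', y')) = yᵀ Diag(k_1(x, x'), …, k_{m+1}(x, x')) y'`. -/
def kc (x : EuclideanSpace ℝ (Fin n)) (y : Fin (m + 1) → ℝ)
    (x' : EuclideanSpace ℝ (Fin n)) (y' : Fin (m + 1) → ℝ) : ℝ :=
  y ⬝ᵥ (Matrix.diagonal (fun i => S.k i x x') *ᵥ y')

/-- The Gram matrix `K_c` of the compound kernel on the data inputs. -/
def gram (D : Dataset n m) : Matrix (Fin D.length) (Fin D.length) ℝ :=
  Matrix.of fun i j => S.kc (D.get i).x (aug (D.get i).u) (D.get j).x (aug (D.get j).u)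

/-- The matrix `K_{*Y}`, with entries `k_i(x, x_j) (y_j)_i`. -/
def KsY (x : EuclideanSpace ℝ (Fin n)) (D : Dataset n m) :
    Matrix (Fin (m + 1)) (Fin D.length) ℝ :=
  Matrix.of fun i j => S.k i x (D.get j).x * aug (D.get j).u i

/-- The matrix `(K_c + σ_n² I)⁻¹`. -/
def gramInv (D : Dataset n m) : Matrix (Fin D.length) (Fin D.length) ℝ :=
  (S.gram D + S.σn ^ 2 • (1 : Matrix (Fin D.length) (Fin D.length) ℝ))⁻¹

/-- The vector `m_B(x | 𝔻)`, given by `m_Bᵀ = zᵀ (K_c + σ_n² I)⁻¹ K_{*Y}ᵀ`. -/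
def mB (x : EuclideanSpace ℝ (Fin n)) (D : Dataset n m) : Fin (m + 1) → ℝ :=
  (fun j => (D.get j).z) ᵥ* (S.gramInv D * (S.KsY x D)ᵀ)

/-- The matrix `Σ_B(x | 𝔻) = K_{**} - K_{*Y} (K_c + σ_n² I)⁻¹ K_{*Y}ᵀ`. -/
def SigmaB (x : EuclideanSpace ℝ (Fin n)) (D : Dataset n m) :
    Matrix (Fin (m + 1)) (Fin (m + 1)) ℝ :=
  Matrix.diagonal (fun i => S.k i x x) - S.KsY x D * S.gramInv D * (S.KsY x D)ᵀ

/-- The mean `μ_B(x, u | 𝔻)` of the prediction of `Δ_B(x, u)`. -/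
def μB (x : EuclideanSpace ℝ (Fin n)) (u : EuclideanSpace ℝ (Fin m)) (D : Dataset n m) : ℝ :=
  S.mB x D ⬝ᵥ aug u

/-- The standard deviation `σ_B(x, u | 𝔻)` of the prediction of `Δ_B(x, u)`. -/
def σB (x : EuclideanSpace ℝ (Fin n)) (u : EuclideanSpace ℝ (Fin m)) (D : Dataset n m) : ℝ :=
  Real.sqrt (aug u ⬝ᵥ (S.SigmaB x D *ᵥ aug u))

/-! ### The probabilistic safety filter (GP-CBF-SOCP) -/

/-- The inputs that satisfy the chance constraint at `x`:
`L_f̃ B + L_g̃ B u + μ_B - β σ_B + γ(B) ≥ 0`. -/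
def feasibleSet (x : EuclideanSpace ℝ (Fin n)) (D : Dataset n m) :
    Set (EuclideanSpace ℝ (Fin m)) :=
  {u | 0 ≤ S.LfNomB x + S.LgNomB x ⬝ᵥ u.ofLp + S.μB x u D
    - S.β D.length * S.σB x u D + S.γ (S.B x)}

/-- `u` solves the GP-CBF-SOCP at `x`. -/
def IsSOCPSolution (x : EuclideanSpace ℝ (Fin n)) (D : Dataset n m)
    (u : EuclideanSpace ℝ (Fin m)) : Prop :=
  u ∈ S.feasibleSet x D ∧ IsMinOn (fun v => ‖v - S.uRef x‖ ^ 2) (S.feasibleSet x D) u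

open Classical in
/-- The solution `u*(x | 𝔻)` of the GP-CBF-SOCP; the value `0` where there is none is never used,
because the program is only solved where `λ_†` is negative, where it is feasible. -/
def uStar (x : EuclideanSpace ℝ (Fin n)) (D : Dataset n m) : EuclideanSpace ℝ (Fin m) :=
  if h : ∃ u, S.IsSOCPSolution x D u then h.choose else 0

/-! ### The feasibility tradeoff matrix and the backup input -/

/-- The mean prediction of the row vector `L_g B(x)`. -/
def LgHat (x : EuclideanSpace ℝ (Fin n)) (D : Dataset n m) : Fin m → ℝ :=
  fun j => S.LgNomB x j + S.mB x D j.succ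

/-- The lower right `m × m` block of `Σ_B(x | 𝔻)`. -/
def SigmaLgB (x : EuclideanSpace ℝ (Fin n)) (D : Dataset n m) : Matrix (Fin m) (Fin m) ℝ :=
  (S.SigmaB x D).submatrix Fin.succ Fin.succ

/-- The feasibility tradeoff matrix `β² Σ_{L_g B} - (L̂_g B)ᵀ (L̂_g B)`. -/
def tradeoff (x : EuclideanSpace ℝ (Fin n)) (D : Dataset n m) : Matrix (Fin m) (Fin m) ℝ :=
  S.β D.length ^ 2 • S.SigmaLgB x D - Matrix.vecMulVec (S.LgHat x D) (S.LgHat x D)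

/-- `λ_†(x | 𝔻)`, the minimum eigenvalue of the (symmetric) feasibility tradeoff matrix. -/
def lamDag (x : EuclideanSpace ℝ (Fin n)) (D : Dataset n m) : ℝ :=
  sInf {μ : ℝ | ∃ v : Fin m → ℝ, v ≠ 0 ∧ S.tradeoff x D *ᵥ v = μ • v}

/-- `e` is a unit eigenvector of the feasibility tradeoff matrix for `λ_†`. -/
def IsUnitEigenvector (x : EuclideanSpace ℝ (Fin n)) (D : Dataset n m)
    (e : EuclideanSpace ℝ (Fin m)) : Prop :=
  ‖e‖ = 1 ∧ S.tradeoff x D *ᵥ e.ofLp = S.lamDag x D • e.ofLp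

open Classical in
/-- `e_†(x | 𝔻)`, a unit eigenvector for `λ_†`. -/
def eDag (x : EuclideanSpace ℝ (Fin n)) (D : Dataset n m) : EuclideanSpace ℝ (Fin m) :=
  if h : ∃ e, S.IsUnitEigenvector x D e then h.choose else 0

/-- `u_safe(x | 𝔻) = α sgn(L̂_g B e_†) e_†`. -/
def uSafe (x : EuclideanSpace ℝ (Fin n)) (D : Dataset n m) : EuclideanSpace ℝ (Fin m) :=
  (S.α x D * Real.sign (S.LgHat x D ⬝ᵥ (S.eDag x D).ofLp)) • S.eDag x D

/-! ### The algorithm -/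

open Classical in
/-- The switched control law of the algorithm for the current dataset. -/
def policy (x : EuclideanSpace ℝ (Fin n)) (D : Dataset n m) : EuclideanSpace ℝ (Fin m) :=
  if S.lamDag x D < -S.ε then S.uStar x D else S.uSafe x D

/-- The dataset after one update: the input of the control law is applied at the state `x` and
the resulting noisy measurement of `Δ_B` is added. -/
def update (x : EuclideanSpace ℝ (Fin n)) (D : Dataset n m) : Dataset n m :=
  D ++ [⟨x, S.policy x D, S.ΔB x (S.policy x D) + S.noise D.length⟩]

/-- `t mod τ = 0`. -/
def IsTimeTrigger (t : ℝ) : Prop := ∃ k : ℕ, t = k * S.τ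

/-- `D'` is the dataset with which the passes of the algorithm through its loop at the instant `t`
end, if they start from the dataset `D` at the state `x`. The time trigger causes one update at
the instants `t` with `t mod τ = 0`; the event trigger causes an update in each pass in which
`λ_† ≥ -ε`. So `D'` results from `D` by the first number `j` of updates, with `j ≥ 1` if
`t mod τ = 0`, after which `λ_† < -ε`. -/
def LoopEndsWith (t : ℝ) (x : EuclideanSpace ℝ (Fin n)) (D D' : Dataset n m) : Prop :=
  ∃ j : ℕ, (S.IsTimeTrigger t → 1 ≤ j) ∧ D' = (S.update x)^[j] D ∧ S.lamDag x D' < -S.ε ∧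
    ∀ i < j, (S.IsTimeTrigger t → 1 ≤ i) → -S.ε ≤ S.lamDag x ((S.update x)^[i] D)

/-- `Dpre` is the dataset just before the updates at the instant `t`, if `D s` is the dataset after
the updates at the instant `s`: the initial dataset for `t = 0`, and the left limit for `t > 0`. -/
def IsPre (D₀ : Dataset n m) (D : ℝ → Dataset n m) (t : ℝ) (Dpre : Dataset n m) : Prop :=
  (t = 0 ∧ Dpre = D₀) ∨ (0 < t ∧ ∀ᶠ s in 𝓝[<] t, D s = Dpre)

/-- `(x, D)` is a solution on `[0, T)` of the true plant in closed loop with the algorithm, started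
at `x₀` with the dataset `D₀`. Here `D t` is the dataset after the updates at the instant `t`; it is
piecewise constant and right continuous. The plant equation is stated with right derivatives;
since `x` is continuous, it holds in the classical sense at all times without an update. -/
structure IsExecution (x₀ : EuclideanSpace ℝ (Fin n)) (D₀ : Dataset n m) (T : ℝ)
    (x : ℝ → EuclideanSpace ℝ (Fin n)) (D : ℝ → Dataset n m) : Prop where
  init : x 0 = x₀
  mem : ∀ t ∈ Ico 0 T, x t ∈ S.X
  cont : ContinuousOn x (Ico 0 T)
  data_update : ∀ t ∈ Ico 0 T, ∃ Dpre, IsPre D₀ D t Dpre ∧ S.LoopEndsWith t (x t) Dpre (D t)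
  data_const : ∀ t ∈ Ico 0 T, ∀ᶠ s in 𝓝[>] t, D s = D t
  plant : ∀ t ∈ Ico 0 T,
    HasDerivWithinAt x (S.f (x t) + S.g (x t) (S.policy (x t) (D t))) (Ici t) t

/-! ### The assumptions -/

/-- A symmetric positive semidefinite kernel on `X` that does not vanish on the diagonal. -/
def IsKernelOn (X : Set (EuclideanSpace ℝ (Fin n)))
    (κ : EuclideanSpace ℝ (Fin n) → EuclideanSpace ℝ (Fin n) → ℝ) : Prop :=
  (∀ (N : ℕ) (p : Fin N → EuclideanSpace ℝ (Fin n)), (∀ i, p i ∈ X) →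
    (Matrix.of fun i j => κ (p i) (p j)).PosSemidef) ∧ ∀ x ∈ X, 0 < κ x x

/-- The standing assumptions on the plant, the kernels and the parameters. -/
structure Standing : Prop where
  isOpen_X : IsOpen S.X
  lip_f : LocallyLipschitzOn S.X S.f
  lip_g : LocallyLipschitzOn S.X S.g
  contDiff_B : ContDiffOn ℝ 1 S.B S.X
  kernel : ∀ i, IsKernelOn S.X (S.k i)
  σn_pos : 0 < S.σn
  β_pos : ∀ N, 0 < S.β N
  ε_pos : 0 < S.ε
  τ_pos : 0 < S.τ
  α_pos : ∀ x D, 0 < S.α x D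

/-- All data inputs of the dataset are states in `X`. -/
def DataIn (D : Dataset n m) : Prop := ∀ p ∈ D, p.x ∈ S.X

/-- The functions that define the GP-CBF-SOCP are twice continuously differentiable in the state,
for each fixed dataset and input. -/
structure TwiceContDiff : Prop where
  LfNomB : ContDiffOn ℝ 2 S.LfNomB S.X
  LgNomB : ContDiffOn ℝ 2 S.LgNomB S.X
  γB : ContDiffOn ℝ 2 (fun x => S.γ (S.B x)) S.X
  uRef : ContDiffOn ℝ 2 S.uRef S.X
  μB : ∀ D, S.DataIn D → ∀ u, ContDiffOn ℝ 2 (fun x => S.μB x u D) S.X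
  σB : ∀ D, S.DataIn D → ∀ u, ContDiffOn ℝ 2 (fun x => S.σB x u D) S.X

/-- Along every solution that starts at `x₀` with the dataset `D₀`, the mean prediction of `L_g B`
does not vanish. -/
def PredictedRelDegreeOne (x₀ : EuclideanSpace ℝ (Fin n)) (D₀ : Dataset n m) : Prop :=
  ∀ T x D, S.IsExecution x₀ D₀ T x D → ∀ t ∈ Ico 0 T, S.LgHat (x t) (D t) ≠ 0

/-- At every event-triggered update (from a dataset `D'` to `S.update (x t) D'`) along every
solution that starts at `x₀` with the dataset `D₀`, the new mean prediction of `L_g B` does not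
cancel the previous safe direction. -/
def TriggeringCondition (x₀ : EuclideanSpace ℝ (Fin n)) (D₀ : Dataset n m) : Prop :=
  ∀ T x D, S.IsExecution x₀ D₀ T x D → ∀ t ∈ Ico 0 T, ∀ Dpre, IsPre D₀ D t Dpre →
    ∀ i : ℕ, Dpre.length + i < (D t).length →
      -S.ε ≤ S.lamDag (x t) ((S.update (x t))^[i] Dpre) →
      S.LgHat (x t) ((S.update (x t))^[i + 1] Dpre) ⬝ᵥ
        (S.eDag (x t) ((S.update (x t))^[i] Dpre)).ofLp ≠ 0

end LearningSetup

end

/-!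
The updates at one instant are determined by the state and the dataset just before, so all that
has to be shown is that, as long as the dataset does not change, the closed loop is an ordinary
differential equation with a locally Lipschitz right-hand side. Then the Picard–Lindelöf theorem
gives a solution for a short time after the initial updates (`exists_isExecution`), and two
solutions agree by induction along the time axis: agreement before `t` passes to `t` by continuity
of the state and determinism of the updates (`IsExecution.eq_of_eqOn_Ico`), and agreement at `t`
persists for a while because the datasets are constant to the right of `t` and Grönwall's inequality
applies (`IsExecution.eventually_eq`). Uniqueness on all of `[0, T)` needs no lower bound on the
time between updates.

After the updates at an instant, `λ_† < -ε`, and this persists near the current state, so the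
control law is the solution `u*` of the second-order cone program. The heart of the matter is that
`u*` is locally Lipschitz in the state (`exists_lipschitzOnWith_uStar`).

* The posterior covariance `Σ_B` is positive definite, as a Schur complement (`SigmaB_posDef`).
  Hence `σ_B` has no zero, and the constraint function, which is concave in the input, is jointly
  twice continuously differentiable in the state and the input (`constraint_contDiffOn`); joint
  smoothness follows from smoothness in the state for each fixed input, because `σ_B²` is quadratic
  and `μ_B` affine in the input.
* A negative eigenvalue of the tradeoff matrix yields Slater's condition (`exists_constraint_pos`).
* The projection of a point onto a set `{u | 0 ≤ h x u}`, with `h` concave in `u`, jointly `C²`, and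
  subject to Slater's condition, is locally Lipschitz in `x` (`exists_lipschitzOnWith_of_isMinOn`).
  Slater's condition bounds the `u`-derivative of `h` away from zero on the boundary of the set.
  So there are bounded Karush–Kuhn–Tucker multipliers, whose difference is controlled by the
  distance of the parameters and of the solutions; testing the two stationarity conditions with the
  difference of the solutions gives the estimate (`norm_sub_le_of_multipliers`).
-/

open scoped RealInnerProductSpace NNReal

/-! ### Projection onto superlevel sets of concave functions -/

theorem ConcaveOn.le_add_hasFDerivAt {U : Type*} [NormedAddCommGroup U] [NormedSpace ℝ U]
    {φ : U → ℝ} (hφ : ConcaveOn ℝ univ φ) {φ' : U →L[ℝ] ℝ} {u : U} (hd : HasFDerivAt φ φ' u)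
    (v : U) : φ v ≤ φ u + φ' (v - u) := by
  have hc : ConcaveOn ℝ univ (fun t : ℝ => φ (AffineMap.lineMap u v t)) := by
    simpa [Function.comp_def] using hφ.comp_affineMap (AffineMap.lineMap (k := ℝ) u v)
  have hl : HasDerivAt (fun t : ℝ => AffineMap.lineMap (k := ℝ) u v t) (v - u) 0 :=
    AffineMap.hasDerivAt_lineMap
  have hd0 : HasDerivAt (fun t : ℝ => φ (AffineMap.lineMap u v t)) (φ' (v - u)) 0 := by
    have hd' : HasFDerivAt φ φ' (AffineMap.lineMap (k := ℝ) u v (0 : ℝ)) := by simpa using hd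
    exact hd'.comp_hasDerivAt (0 : ℝ) hl
  have := hc.slope_le_of_hasDerivAt (mem_univ 0) (mem_univ 1) one_pos hd0
  simp [slope_def_field] at this
  rw [map_sub]
  linarith

/-- The Karush–Kuhn–Tucker conditions for the projection of `r` onto `{v | 0 ≤ φ v}`. -/
theorem exists_multiplier_of_isMinOn {U : Type*} [NormedAddCommGroup U] [InnerProductSpace ℝ U]
    {φ : U → ℝ} {φ' : U →L[ℝ] ℝ} {r u : U} (hd : HasFDerivAt φ φ' u) (hu : 0 ≤ φ u)
    (hmin : IsMinOn (fun v => ‖v - r‖ ^ 2) {v | 0 ≤ φ v} u) (hreg : φ u = 0 → φ' ≠ 0) :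
    ∃ c : ℝ, 0 ≤ c ∧ c * φ u = 0 ∧ ∀ w, ⟪u - r, w⟫ = c * φ' w := by
  -- The distance to `r` does not decrease in a direction that leads into the feasible set.
  have key : ∀ v, (0 < φ u ∨ 0 < φ' v) → 0 ≤ ⟪u - r, v⟫ := by
    intro v hv
    have hl : HasDerivAt (fun t : ℝ => u + t • v) v 0 := by
      simpa using ((hasDerivAt_id (0 : ℝ)).smul_const v).const_add u
    have hd0 : HasDerivAt (fun t : ℝ => φ (u + t • v)) (φ' v) 0 := by
      have hd' : HasFDerivAt φ φ' (u + (0 : ℝ) • v) := by simpa using hd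
      exact hd'.comp_hasDerivAt (0 : ℝ) hl
    have hfeas : ∀ᶠ t : ℝ in 𝓝[>] 0, 0 ≤ φ (u + t • v) := by
      rcases hu.lt_or_eq with h0 | h0
      · have : ∀ᶠ t : ℝ in 𝓝 0, 0 < φ (u + t • v) :=
          hd0.continuousAt.eventually_const_lt (by simpa using h0)
        exact (this.filter_mono nhdsWithin_le_nhds).mono fun t ht => ht.le
      · have hv' : 0 < φ' v := hv.resolve_left (by rw [← h0]; exact lt_irrefl 0)
        have := (hasDerivWithinAt_iff_tendsto_slope'
          self_notMem_Ioi).1 (hd0.hasDerivWithinAt (s := Ioi 0))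
        filter_upwards [this.eventually_const_lt hv', self_mem_nhdsWithin] with t ht ht0
        have ht0' : (0 : ℝ) < t := ht0
        rw [slope_def_field] at ht
        simp only [zero_smul, add_zero, ← h0, sub_zero] at ht
        exact ((div_pos_iff_of_pos_right ht0').1 ht).le
    have hquad : ∀ᶠ t : ℝ in 𝓝[>] 0, 0 ≤ 2 * ⟪u - r, v⟫ + t * ‖v‖ ^ 2 := by
      filter_upwards [hfeas, self_mem_nhdsWithin] with t ht ht0
      have ht0' : (0 : ℝ) < t := ht0
      have h1 : ‖u - r‖ ^ 2 ≤ ‖u + t • v - r‖ ^ 2 := hmin ht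
      have h2 : u + t • v - r = (u - r) + t • v := by abel
      rw [h2, norm_add_sq_real, inner_smul_right, norm_smul, Real.norm_of_nonneg ht0'.le] at h1
      have h3 : 0 ≤ t * (2 * ⟪u - r, v⟫ + t * ‖v‖ ^ 2) := by nlinarith
      exact nonneg_of_mul_nonneg_right h3 ht0'
    have hlim : Tendsto (fun t : ℝ => 2 * ⟪u - r, v⟫ + t * ‖v‖ ^ 2) (𝓝[>] 0)
        (𝓝 (2 * ⟪u - r, v⟫)) := by
      have : Continuous fun t : ℝ => 2 * ⟪u - r, v⟫ + t * ‖v‖ ^ 2 := by fun_prop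
      exact (this.tendsto' 0 _ (by simp)).mono_left nhdsWithin_le_nhds
    have := ge_of_tendsto hlim hquad
    linarith
  rcases hu.lt_or_eq with h0 | h0
  · refine ⟨0, le_rfl, zero_mul _, fun w => ?_⟩
    have h1 := key w (Or.inl h0)
    have h2 := key (-w) (Or.inl h0)
    rw [inner_neg_right] at h2
    linarith
  · obtain ⟨w₁, hw₁⟩ : ∃ w, φ' w ≠ 0 := by
      by_contra! h
      exact hreg h0.symm (ContinuousLinearMap.ext h)
    obtain ⟨w₀, hw₀⟩ : ∃ w, φ' w = 1 := ⟨(φ' w₁)⁻¹ • w₁, by simp [hw₁]⟩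
    have hker : ∀ v, φ' v = 0 → 0 ≤ ⟪u - r, v⟫ := by
      intro v hv
      refine le_of_forall_pos_le_add fun η hη => ?_
      have hs : 0 < η / (|⟪u - r, w₀⟫| + 1) := by positivity
      have h1 := key (v + (η / (|⟪u - r, w₀⟫| + 1)) • w₀) (Or.inr (by simp [hv, hw₀, hs]))
      rw [inner_add_right, inner_smul_right] at h1
      have h2 : η / (|⟪u - r, w₀⟫| + 1) * ⟪u - r, w₀⟫ ≤ η := by
        rw [div_mul_eq_mul_div, div_le_iff₀ (by positivity)]
        nlinarith [le_abs_self ⟪u - r, w₀⟫]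
      linarith
    refine ⟨⟪u - r, w₀⟫, key w₀ (Or.inr (by simp [hw₀])), by rw [← h0, mul_zero], fun w => ?_⟩
    have h1 := hker (w - φ' w • w₀) (by simp [hw₀])
    have h2 := hker (-(w - φ' w • w₀)) (by simp [hw₀])
    rw [inner_neg_right] at h2
    rw [inner_sub_right, inner_smul_right] at h1 h2
    linarith

/-- Two projections onto superlevel sets of concave functions `h₁`, `h₂`, with multipliers `c₁`,
`c₂` and derivatives `G₁`, `G₂` at the solutions, are at a distance controlled by the distance `d`
of the data. The second-order information enters through `hΦ`: the increment of `h₁ - h₂` between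
the solutions is of the order of `d` times the distance of the solutions. -/
theorem norm_sub_le_of_multipliers {U : Type*} [NormedAddCommGroup U] [InnerProductSpace ℝ U]
    {h₁ h₂ : U → ℝ} {G₁ G₂ : U →L[ℝ] ℝ} {u₁ u₂ r₁ r₂ : U} {c₁ c₂ d L Λ ρ κ : ℝ}
    (hd : 0 ≤ d) (hL : 0 ≤ L) (hρ : 0 ≤ ρ) (hκ : 0 < κ)
    (hfeas₁ : 0 ≤ h₁ u₁) (hfeas₂ : 0 ≤ h₂ u₂)
    (hconc₁ : h₁ u₂ ≤ h₁ u₁ + G₁ (u₂ - u₁)) (hconc₂ : h₂ u₁ ≤ h₂ u₂ + G₂ (u₁ - u₂))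
    (hc₁ : 0 ≤ c₁) (hc₂ : 0 ≤ c₂) (hc₁Λ : c₁ ≤ Λ) (hc₂Λ : c₂ ≤ Λ)
    (hcompl₁ : c₁ * h₁ u₁ = 0) (hcompl₂ : c₂ * h₂ u₂ = 0)
    (hstat₁ : ∀ w, ⟪u₁ - r₁, w⟫ = c₁ * G₁ w) (hstat₂ : ∀ w, ⟪u₂ - r₂, w⟫ = c₂ * G₂ w)
    (hG₁ : 0 < c₁ → κ ≤ ‖G₁‖) (hG₂ : 0 < c₂ → κ ≤ ‖G₂‖)
    (hr : ‖r₁ - r₂‖ ≤ ρ * d) (hG : ‖G₁ - G₂‖ ≤ L * (d + ‖u₁ - u₂‖))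
    (hh : |h₁ u₁ - h₂ u₁| ≤ L * d)
    (hΦ : |(h₁ u₁ - h₂ u₁) - (h₁ u₂ - h₂ u₂)| ≤ L * d * ‖u₁ - u₂‖) :
    ‖u₁ - u₂‖ ≤ (ρ + Λ * L + 2 * ((1 + ρ + Λ * L) / κ * L) + 1) * d := by
  have hΛ : 0 ≤ Λ := hc₁.trans hc₁Λ
  set D := ‖u₁ - u₂‖ with hD
  have hD0 : 0 ≤ D := norm_nonneg _
  have hA : 0 ≤ 1 + ρ + Λ * L := by positivity
  have hp : ‖(u₁ - r₁) - (u₂ - r₂)‖ ≤ D + ρ * d := by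
    have : (u₁ - r₁) - (u₂ - r₂) = (u₁ - u₂) - (r₁ - r₂) := by abel
    rw [this]
    exact (norm_sub_le _ _).trans (by linarith)
  -- The multipliers differ by at most a multiple of `d + D`.
  have hmul : |c₁ - c₂| * κ ≤ (1 + ρ + Λ * L) * (d + D) := by
    have main : ∀ (a b : ℝ) (A B : U →L[ℝ] ℝ) (p q : U), 0 ≤ b → b ≤ Λ →
        (∀ w, ⟪p, w⟫ = a * A w) → (∀ w, ⟪q, w⟫ = b * B w) → κ ≤ ‖A‖ →
        ‖p - q‖ ≤ D + ρ * d → ‖A - B‖ ≤ L * (d + D) →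
        |a - b| * κ ≤ (1 + ρ + Λ * L) * (d + D) := by
      intro a b A B p q hb hbΛ hpA hqB hκA hpq hAB
      have h1 : ‖(a - b) • A‖ ≤ ‖p - q‖ + b * ‖A - B‖ := by
        refine ContinuousLinearMap.opNorm_le_bound _ (by positivity) fun w => ?_
        have h2 : ((a - b) • A) w = ⟪p - q, w⟫ - b * (A - B) w := by
          simp only [smul_apply, sub_apply, smul_eq_mul,
            inner_sub_left, hpA, hqB]
          ring
        rw [h2, add_mul]
        refine (norm_sub_le _ _).trans (add_le_add (norm_inner_le_norm _ _) ?_)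
        rw [norm_mul, Real.norm_of_nonneg hb, mul_assoc]
        gcongr
        exact (A - B).le_opNorm w
      rw [norm_smul, Real.norm_eq_abs] at h1
      calc |a - b| * κ ≤ |a - b| * ‖A‖ := by gcongr
        _ ≤ ‖p - q‖ + b * ‖A - B‖ := h1
        _ ≤ (D + ρ * d) + Λ * (L * (d + D)) := by gcongr
        _ ≤ (1 + ρ + Λ * L) * (d + D) := by nlinarith [mul_nonneg hρ hD0]
    rcases hc₁.lt_or_eq with h | h
    · exact main c₁ c₂ G₁ G₂ _ _ hc₂ hc₂Λ hstat₁ hstat₂ (hG₁ h) hp hG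
    rcases hc₂.lt_or_eq with h' | h'
    · rw [abs_sub_comm]
      exact main c₂ c₁ G₂ G₁ _ _ hc₁ hc₁Λ hstat₂ hstat₁ (hG₂ h') (by rwa [norm_sub_rev])
        (by rwa [norm_sub_rev])
    · rw [← h, ← h']
      simp only [sub_zero, abs_zero, zero_mul]
      positivity
  have hmul' : |c₁ - c₂| ≤ (1 + ρ + Λ * L) / κ * (d + D) := by
    rw [div_mul_eq_mul_div, le_div_iff₀ hκ]
    exact hmul
  -- Testing the stationarity conditions with the difference of the solutions.
  have hsq : D ^ 2 ≤ ρ * d * D + Λ * (L * d * D) + |c₁ - c₂| * (L * d) := by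
    have e1 : D ^ 2 = ⟪u₁ - r₁, u₁ - u₂⟫ - ⟪u₂ - r₂, u₁ - u₂⟫ + ⟪r₁ - r₂, u₁ - u₂⟫ := by
      rw [hD, ← real_inner_self_eq_norm_sq, ← inner_sub_left, ← inner_add_left]
      congr 1
      abel
    have e2 : ⟪r₁ - r₂, u₁ - u₂⟫ ≤ ρ * d * D :=
      (real_inner_le_norm _ _).trans (by gcongr)
    have e3 : ⟪u₁ - r₁, u₁ - u₂⟫ ≤ -(c₁ * (h₁ u₂ - h₂ u₂)) := by
      rw [hstat₁]
      have : G₁ (u₂ - u₁) = -G₁ (u₁ - u₂) := by rw [← map_neg, neg_sub]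
      nlinarith [mul_nonneg hc₁ hfeas₂, mul_le_mul_of_nonneg_left hconc₁ hc₁]
    have e4 : -⟪u₂ - r₂, u₁ - u₂⟫ ≤ c₂ * (h₁ u₁ - h₂ u₁) := by
      rw [hstat₂]
      nlinarith [mul_nonneg hc₂ hfeas₁, mul_le_mul_of_nonneg_left hconc₂ hc₂]
    have e5 : c₁ * ((h₁ u₁ - h₂ u₁) - (h₁ u₂ - h₂ u₂)) ≤ Λ * (L * d * D) :=
      (mul_le_mul_of_nonneg_left ((le_abs_self _).trans hΦ) hc₁).trans
        (mul_le_mul_of_nonneg_right hc₁Λ (by positivity))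
    have e6 : (c₂ - c₁) * (h₁ u₁ - h₂ u₁) ≤ |c₁ - c₂| * (L * d) := by
      refine (le_abs_self _).trans ?_
      rw [abs_mul, abs_sub_comm c₂]
      gcongr
    linarith
  have hfin : D ^ 2 ≤ ρ * d * D + Λ * (L * d * D)
      + ((1 + ρ + Λ * L) / κ * L) * (d * (d + D)) := by
    refine hsq.trans ?_
    have := mul_le_mul_of_nonneg_right hmul' (show 0 ≤ L * d by positivity)
    linarith
  set M := (1 + ρ + Λ * L) / κ * L
  have hM : 0 ≤ M := by positivity
  by_contra! hlt
  have hN : 0 ≤ ρ + Λ * L + 2 * M := by positivity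
  have hdD : d ≤ D := by nlinarith
  have hDpos : 0 < D := lt_of_le_of_lt (by positivity) hlt
  have h1 : D ^ 2 ≤ (ρ + Λ * L + 2 * M) * d * D := by
    nlinarith [mul_nonneg hM (mul_nonneg hd (sub_nonneg.2 hdD))]
  have h2 : D ≤ (ρ + Λ * L + 2 * M) * d := by
    rw [sq] at h1
    exact le_of_mul_le_mul_right h1 hDpos
  linarith

/-- The projection onto the superlevel sets `{u | 0 ≤ h x u}` of functions that are concave in `u`
and jointly twice continuously differentiable depends locally Lipschitz continuously on the
parameter `x`, if Slater's condition holds. Any selection `s` of minimizers is meant: the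
minimizers are in fact unique. -/
theorem exists_lipschitzOnWith_of_isMinOn {E U : Type*}
    [NormedAddCommGroup E] [NormedSpace ℝ E] [FiniteDimensional ℝ E]
    [NormedAddCommGroup U] [InnerProductSpace ℝ U] [FiniteDimensional ℝ U]
    {X : Set E} (hX : IsOpen X) {h : E → U → ℝ}
    (hh : ContDiffOn ℝ 2 (fun p : E × U => h p.1 p.2) (X ×ˢ univ))
    (hconc : ∀ x ∈ X, ConcaveOn ℝ univ (h x))
    {r : E → U} (hr : ContDiffOn ℝ 1 r X) {x₀ : E} (hx₀ : x₀ ∈ X) {û : U} (hû : 0 < h x₀ û)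
    {s : E → U} (hs : ∀ᶠ x in 𝓝 x₀, 0 ≤ h x (s x) ∧
      IsMinOn (fun v => ‖v - r x‖ ^ 2) {v | 0 ≤ h x v} (s x)) :
    ∃ K : ℝ≥0, ∃ t ∈ 𝓝 x₀, LipschitzOnWith K s t := by
  set H : E × U → ℝ := fun p => h p.1 p.2 with hH
  have hXU : IsOpen (X ×ˢ (univ : Set U)) := hX.prod isOpen_univ
  have hdiff : ∀ x ∈ X, ∀ u, HasFDerivAt (h x)
      ((fderiv ℝ H (x, u)).comp (ContinuousLinearMap.inr ℝ E U)) u := by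
    intro x hx u
    have h1 : HasFDerivAt H (fderiv ℝ H (x, u)) (x, u) :=
      ((hh.contDiffAt (hXU.mem_nhds ⟨hx, mem_univ u⟩)).differentiableAt
        (by norm_num)).hasFDerivAt
    exact h1.comp u (hasFDerivAt_prodMk_right x u)
  have hslice : ContinuousAt (fun x => h x û) x₀ := by
    have h1 : ContinuousAt H (x₀, û) :=
      (hh.contDiffAt (hXU.mem_nhds ⟨hx₀, mem_univ û⟩)).continuousAt
    exact h1.comp (f := fun x => (x, û)) (by fun_prop)
  obtain ⟨ρ, tr, htr, hρ⟩ := (hr.contDiffAt (hX.mem_nhds hx₀)).exists_lipschitzOnWith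
  have hev : ∀ᶠ x in 𝓝 x₀, (x ∈ X ∧ h x₀ û / 2 < h x û) ∧ x ∈ tr ∧
      (0 ≤ h x (s x) ∧ IsMinOn (fun v => ‖v - r x‖ ^ 2) {v | 0 ≤ h x v} (s x)) :=
    ((hX.eventually_mem hx₀).and (hslice.eventually_const_lt (half_lt_self hû))).and
      ((eventually_mem_set.2 htr).and hs)
  obtain ⟨δ, hδ, hball⟩ := Metric.nhds_basis_closedBall.eventually_iff.1 hev
  set W := Metric.closedBall x₀ δ with hW
  have hx₀W : x₀ ∈ W := Metric.mem_closedBall_self hδ.le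
  -- All projections of points near `x₀` lie in the ball of radius `R`.
  set R₀ := ‖û‖ + ‖r x₀‖ + ρ * δ with hR₀
  set R := 2 * R₀ with hR
  have hR₀0 : 0 ≤ R₀ := by positivity
  have hrb : ∀ x ∈ W, ‖r x‖ ≤ ‖r x₀‖ + ρ * δ := by
    intro x hx
    have h1 := hρ.norm_sub_le (hball hx).2.1 (hball hx₀W).2.1
    have h2 : ‖x - x₀‖ ≤ δ := by rwa [← mem_closedBall_iff_norm]
    have h3 : ‖r x‖ ≤ ‖r x - r x₀‖ + ‖r x₀‖ := norm_le_norm_sub_add _ _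
    have h4 : (ρ : ℝ) * ‖x - x₀‖ ≤ ρ * δ := by gcongr
    linarith
  have hûfeas : ∀ x ∈ W, 0 ≤ h x û := fun x hx => by
    have := (hball hx).1.2
    linarith
  have hdist : ∀ x ∈ W, ‖s x - r x‖ ≤ R₀ := by
    intro x hx
    have h1 : ‖s x - r x‖ ^ 2 ≤ ‖û - r x‖ ^ 2 := (hball hx).2.2.2 (hûfeas x hx)
    have h2 : ‖s x - r x‖ ≤ ‖û - r x‖ := le_of_sq_le_sq h1 (norm_nonneg _)
    have h3 := norm_sub_le û (r x)
    have h4 := hrb x hx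
    linarith
  have hsR : ∀ x ∈ W, ‖s x‖ ≤ R := by
    intro x hx
    have h1 : ‖s x‖ ≤ ‖s x - r x‖ + ‖r x‖ := norm_le_norm_sub_add _ _
    have h2 := hdist x hx
    have h3 := hrb x hx
    have h4 := norm_nonneg û
    linarith
  -- Lipschitz constants of `h` and of its derivative on a compact convex set.
  set Z := W ×ˢ Metric.closedBall (0 : U) R with hZ
  have hZc : IsCompact Z := (isCompact_closedBall _ _).prod (isCompact_closedBall _ _)
  have hZv : Convex ℝ Z := (convex_closedBall _ _).prod (convex_closedBall _ _)
  have hZX : Z ⊆ X ×ˢ univ := fun p hp => ⟨(hball hp.1).1.1, mem_univ _⟩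
  obtain ⟨L₁, hL₁⟩ := (hh.mono hZX).exists_lipschitzOnWith (by norm_num) hZv hZc
  have hfd : ContDiffOn ℝ 1 (fderiv ℝ H) (X ×ˢ univ) :=
    hh.fderiv_of_isOpen hXU (by norm_num)
  obtain ⟨L₂, hL₂⟩ := (hfd.mono hZX).exists_lipschitzOnWith (by norm_num) hZv hZc
  set G : E → U → U →L[ℝ] ℝ := fun x u =>
    (fderiv ℝ H (x, u)).comp (ContinuousLinearMap.inr ℝ E U) with hG
  have hinr : ‖ContinuousLinearMap.inr ℝ E U‖ ≤ 1 :=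
    ContinuousLinearMap.opNorm_le_bound _ zero_le_one fun u => by simp
  have hGlip : ∀ x ∈ W, ∀ y ∈ W, ∀ u v : U, ‖u‖ ≤ R → ‖v‖ ≤ R →
      ‖G x u - G y v‖ ≤ L₂ * (‖x - y‖ + ‖u - v‖) := by
    intro x hx y hy u v hu hv
    have h1 := hL₂.norm_sub_le (x := (x, u)) (y := (y, v)) ⟨hx, by simpa using hu⟩
      ⟨hy, by simpa using hv⟩
    have h2 : ‖((x, u) : E × U) - (y, v)‖ ≤ ‖x - y‖ + ‖u - v‖ := by
      rw [Prod.mk_sub_mk, Prod.norm_mk]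
      exact max_le_add_of_nonneg (norm_nonneg _) (norm_nonneg _)
    calc ‖G x u - G y v‖
        = ‖(fderiv ℝ H (x, u) - fderiv ℝ H (y, v)).comp (ContinuousLinearMap.inr ℝ E U)‖ := by
          rw [ContinuousLinearMap.sub_comp]
      _ ≤ ‖fderiv ℝ H (x, u) - fderiv ℝ H (y, v)‖ * ‖ContinuousLinearMap.inr ℝ E U‖ :=
          ContinuousLinearMap.opNorm_comp_le _ _
      _ ≤ ‖fderiv ℝ H (x, u) - fderiv ℝ H (y, v)‖ * 1 := by gcongr
      _ ≤ L₂ * (‖x - y‖ + ‖u - v‖) := by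
          rw [mul_one]
          exact h1.trans (by gcongr)
  -- Slater's condition bounds the derivative from below on the boundary of the feasible set.
  set κ := h x₀ û / 2 / (‖û‖ + R + 1) with hκ
  have hκ0 : 0 < κ := by positivity
  have hGκ : ∀ x ∈ W, h x (s x) = 0 → κ ≤ ‖G x (s x)‖ := by
    intro x hx h0
    have h1 := (hconc x (hball hx).1.1).le_add_hasFDerivAt
      (hdiff x (hball hx).1.1 (s x)) û
    have h2 := (hball hx).1.2
    have h3 : G x (s x) (û - s x) ≤ ‖G x (s x)‖ * (‖û‖ + R + 1) := by
      refine (le_abs_self _).trans (((G x (s x)).le_opNorm _).trans ?_)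
      gcongr
      have := norm_sub_le û (s x)
      have := hsR x hx
      linarith
    rw [hκ, div_le_iff₀ (by positivity)]
    rw [h0] at h1
    linarith
  have hmult : ∀ x ∈ W, ∃ c : ℝ, 0 ≤ c ∧ c ≤ R₀ / κ ∧ c * h x (s x) = 0 ∧
      (0 < c → κ ≤ ‖G x (s x)‖) ∧ ∀ w, ⟪s x - r x, w⟫ = c * G x (s x) w := by
    intro x hx
    obtain ⟨c, hc0, hc1, hc2⟩ := exists_multiplier_of_isMinOn (hdiff x (hball hx).1.1 (s x))
      (hball hx).2.2.1 (hball hx).2.2.2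
      (fun h0 hz => by
        have := hGκ x hx h0
        simp only [hG, hz, norm_zero] at this
        linarith)
    have hpos : 0 < c → κ ≤ ‖G x (s x)‖ := fun hc =>
      hGκ x hx ((mul_eq_zero.1 hc1).resolve_left hc.ne')
    refine ⟨c, hc0, ?_, hc1, hpos, hc2⟩
    rcases hc0.lt_or_eq with h0 | h0
    · rw [le_div_iff₀ hκ0]
      have h1 : ‖c • G x (s x)‖ ≤ ‖s x - r x‖ :=
        ContinuousLinearMap.opNorm_le_bound _ (norm_nonneg _) fun w => by
          rw [smul_apply, smul_eq_mul, ← hc2]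
          exact norm_inner_le_norm _ _
      rw [norm_smul, Real.norm_of_nonneg hc0] at h1
      calc c * κ ≤ c * ‖G x (s x)‖ := mul_le_mul_of_nonneg_left (hpos h0) hc0
        _ ≤ R₀ := h1.trans (hdist x hx)
    · rw [← h0]
      positivity
  set L : ℝ := max L₁ L₂ with hL
  have hL0 : 0 ≤ L := le_max_of_le_left L₁.2
  set C := (ρ + R₀ / κ * L + 2 * ((1 + ρ + R₀ / κ * L) / κ * L) + 1 : ℝ) with hC
  have hC0 : 0 ≤ C := by positivity
  refine ⟨⟨C, hC0⟩, W, Metric.closedBall_mem_nhds _ hδ, LipschitzOnWith.of_dist_le_mul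
    fun x hx y hy => ?_⟩
  rw [dist_eq_norm, dist_eq_norm]
  obtain ⟨c₁, hc₁, hc₁', hc₁'', hc₁g, hc₁s⟩ := hmult x hx
  obtain ⟨c₂, hc₂, hc₂', hc₂'', hc₂g, hc₂s⟩ := hmult y hy
  refine norm_sub_le_of_multipliers (h₁ := h x) (h₂ := h y) (norm_nonneg _) hL0 ρ.2 hκ0
    (hball hx).2.2.1 (hball hy).2.2.1
    ((hconc x (hball hx).1.1).le_add_hasFDerivAt (hdiff x (hball hx).1.1 (s x)) _)
    ((hconc y (hball hy).1.1).le_add_hasFDerivAt (hdiff y (hball hy).1.1 (s y)) _)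
    hc₁ hc₂ hc₁' hc₂' hc₁'' hc₂'' hc₁s hc₂s hc₁g hc₂g
    (hρ.norm_sub_le (hball hx).2.1 (hball hy).2.1) ?_ ?_ ?_
  · refine (hGlip x hx y hy _ _ (hsR x hx) (hsR y hy)).trans ?_
    gcongr
    exact le_max_right _ _
  · have h1 := hL₁.norm_sub_le (x := (x, s x)) (y := (y, s x)) ⟨hx, by simpa using hsR x hx⟩
      ⟨hy, by simpa using hsR x hx⟩
    rw [Prod.mk_sub_mk, Prod.norm_mk, sub_self, norm_zero, max_eq_left (norm_nonneg _)] at h1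
    refine h1.trans ?_
    gcongr
    exact le_max_left _ _
  · have h1 := (convex_closedBall (0 : U) R).norm_image_sub_le_of_norm_hasFDerivWithin_le
      (f := fun u => h x u - h y u) (f' := fun u => G x u - G y u) (C := L * ‖x - y‖)
      (fun u _ => ((hdiff x (hball hx).1.1 u).sub (hdiff y (hball hy).1.1 u)).hasFDerivWithinAt)
      (fun u hu => by
        have hu' : ‖u‖ ≤ R := by simpa using hu
        have := hGlip x hx y hy u u hu' hu'
        rw [sub_self, norm_zero, add_zero] at this
        refine this.trans ?_
        gcongr
        exact le_max_right _ _)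
      (x := s y) (y := s x) (by simpa using hsR y hy) (by simpa using hsR x hx)
    simpa using h1

/-! ### Symmetric and positive semidefinite matrices -/

section PosSemidef

open scoped MatrixOrder in
/-- A positive semidefinite matrix `M` induces the seminorm `w ↦ √(wᵀ M w)`. -/
theorem Matrix.PosSemidef.exists_seminorm {ι : Type*} [Fintype ι] {M : Matrix ι ι ℝ}
    (hM : M.PosSemidef) : ∃ N : Seminorm ℝ (ι → ℝ), ∀ w, N w = √(w ⬝ᵥ (M *ᵥ w)) := by
  classical
  obtain ⟨B, rfl⟩ := CStarAlgebra.nonneg_iff_eq_star_mul_self.mp hM.nonneg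
  refine ⟨(normSeminorm ℝ (EuclideanSpace ℝ ι)).comp
    ((WithLp.linearEquiv 2 ℝ (ι → ℝ)).symm.toLinearMap ∘ₗ B.mulVecLin), fun w => ?_⟩
  have h1 : w ⬝ᵥ ((star B * B) *ᵥ w) = (B *ᵥ w) ⬝ᵥ (B *ᵥ w) := by
    rw [← Matrix.mulVec_mulVec, Matrix.dotProduct_mulVec, Matrix.star_eq_conjTranspose,
      Matrix.conjTranspose_eq_transpose_of_trivial, Matrix.vecMul_transpose]
  rw [h1]
  simp [EuclideanSpace.norm_eq, dotProduct, sq]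

/-- The Rayleigh quotient of a symmetric matrix takes a value below `a ≤ 0` if and only if the
least eigenvalue lies below `a`. For `m = 0` the infimum has the value `0`, hence the
restriction on `a`. -/
theorem Matrix.IsHermitian.sInf_eigenvalues_lt_iff {m : ℕ} {M : Matrix (Fin m) (Fin m) ℝ}
    (hM : M.IsHermitian) {a : ℝ} (ha : a ≤ 0) :
    sInf {μ : ℝ | ∃ v : Fin m → ℝ, v ≠ 0 ∧ M *ᵥ v = μ • v} < a ↔
      ∃ v : Fin m → ℝ, v ⬝ᵥ (M *ᵥ v) < a * (v ⬝ᵥ v) := by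
  constructor
  · intro h
    have hne : {μ : ℝ | ∃ v : Fin m → ℝ, v ≠ 0 ∧ M *ᵥ v = μ • v}.Nonempty := by
      by_contra hne
      rw [not_nonempty_iff_eq_empty.1 hne, Real.sInf_empty] at h
      linarith
    obtain ⟨μ, ⟨v, hv, hMv⟩, hμ⟩ := exists_lt_of_csInf_lt hne h
    refine ⟨v, ?_⟩
    rw [hMv, dotProduct_smul, smul_eq_mul]
    have : 0 < v ⬝ᵥ v := by
      simpa using Matrix.dotProduct_star_self_pos_iff.2 hv
    exact mul_lt_mul_of_pos_right hμ this
  · rintro ⟨v, hv⟩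
    have hbdd : BddBelow {μ : ℝ | ∃ v : Fin m → ℝ, v ≠ 0 ∧ M *ᵥ v = μ • v} := by
      refine (M.finite_spectrum.subset ?_).bddBelow
      rintro μ ⟨w, hw, hMw⟩
      rw [← Matrix.spectrum_toLin', ← Module.End.hasEigenvalue_iff_mem_spectrum]
      exact Module.End.hasEigenvalue_of_hasEigenvector
        ⟨Module.End.mem_eigenspace_iff.2 (by simpa using hMw), hw⟩
    by_contra! hle
    have hH : (M - a • (1 : Matrix (Fin m) (Fin m) ℝ)).IsHermitian :=
      hM.sub (by simp [Matrix.IsHermitian])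
    have hps : (M - a • (1 : Matrix (Fin m) (Fin m) ℝ)).PosSemidef := by
      rw [hH.posSemidef_iff_eigenvalues_nonneg]
      intro i
      have h1 := hH.mulVec_eigenvectorBasis i
      have h2 : hH.eigenvalues i + a ∈ {μ : ℝ | ∃ v : Fin m → ℝ, v ≠ 0 ∧ M *ᵥ v = μ • v} := by
        refine ⟨(hH.eigenvectorBasis i).ofLp, fun h0 => ?_, ?_⟩
        · exact hH.eigenvectorBasis.orthonormal.ne_zero i ((WithLp.ofLp_eq_zero 2).1 h0)
        · rw [Matrix.sub_mulVec, Matrix.smul_mulVec, Matrix.one_mulVec, sub_eq_iff_eq_add] at h1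
          rw [h1, add_smul]
      have h3 := hle.trans (csInf_le hbdd h2)
      simp only [Pi.zero_apply]
      linarith
    have := hps.dotProduct_mulVec_nonneg v
    rw [Matrix.sub_mulVec, Matrix.smul_mulVec, Matrix.one_mulVec, dotProduct_sub,
      dotProduct_smul, smul_eq_mul] at this
    simp only [star_trivial] at this
    linarith

end PosSemidef

namespace LearningSetup

variable {n m : ℕ} {S : LearningSetup n m}

/-! ### Positive definiteness of the posterior covariance -/

theorem IsKernelOn.symm {X : Set (EuclideanSpace ℝ (Fin n))}
    {κ : EuclideanSpace ℝ (Fin n) → EuclideanSpace ℝ (Fin n) → ℝ} (hκ : IsKernelOn X κ)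
    {x y : EuclideanSpace ℝ (Fin n)} (hx : x ∈ X) (hy : y ∈ X) : κ x y = κ y x := by
  have h := (hκ.1 2 ![x, y] (by intro i; fin_cases i <;> simp [hx, hy])).isHermitian.apply 1 0
  simpa using h

theorem IsKernelOn.sum_nonneg {X : Set (EuclideanSpace ℝ (Fin n))}
    {κ : EuclideanSpace ℝ (Fin n) → EuclideanSpace ℝ (Fin n) → ℝ} (hκ : IsKernelOn X κ)
    {N : ℕ} {x : EuclideanSpace ℝ (Fin n)} (hx : x ∈ X)
    {p : Fin N → EuclideanSpace ℝ (Fin n)} (hp : ∀ j, p j ∈ X) (a : ℝ) (b : Fin N → ℝ) :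
    0 ≤ a * κ x x * a + 2 * ∑ j, a * κ x (p j) * b j
      + ∑ j, ∑ l, b j * κ (p j) (p l) * b l := by
  have h := (hκ.1 (N + 1) (Fin.cons x p) (by
    intro i
    refine Fin.cases ?_ (fun j => ?_) i
    · simpa using hx
    · simpa using hp j)).dotProduct_mulVec_nonneg (Fin.cons a b)
  simp only [star_trivial, dotProduct, Matrix.mulVec, Matrix.of_apply, Fin.sum_univ_succ,
    Fin.cons_zero, Fin.cons_succ] at h
  refine h.trans_eq ?_
  have h1 : ∀ j, κ (p j) x = κ x (p j) := fun j => hκ.symm (hp j) hx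
  simp only [h1, mul_add, Finset.mul_sum, Finset.sum_add_distrib]
  have h2 : ∑ j, b j * (κ x (p j) * a) = ∑ j, a * (κ x (p j) * b j) :=
    Finset.sum_congr rfl fun j _ => by ring
  rw [h2]
  simp only [two_mul, Finset.sum_add_distrib, mul_assoc]
  ring

/-- The joint covariance of the `m + 1` unknown functions at `x` and of the noise-free
measurements is positive semidefinite: it is a sum of contributions of the kernels. -/
theorem joint_nonneg (hS : S.Standing) {x : EuclideanSpace ℝ (Fin n)} (hx : x ∈ S.X)
    {D : Dataset n m} (hD : S.DataIn D) (a : Fin (m + 1) → ℝ) (b : Fin D.length → ℝ) :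
    0 ≤ a ⬝ᵥ (Matrix.diagonal (fun i => S.k i x x) *ᵥ a) + 2 * (a ⬝ᵥ (S.KsY x D *ᵥ b))
      + b ⬝ᵥ (S.gram D *ᵥ b) := by
  have hp : ∀ j, (D.get j).x ∈ S.X := fun j => hD _ (D.get_mem j)
  have h := Finset.sum_nonneg fun i (_ : i ∈ Finset.univ) =>
    (hS.kernel i).sum_nonneg hx hp (a i) (fun j => aug (D.get j).u i * b j)
  refine h.trans_eq ?_
  simp only [Finset.sum_add_distrib]
  congr 1
  · congr 1
    · simp only [dotProduct, Matrix.mulVec_diagonal]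
      exact Finset.sum_congr rfl fun i _ => by ring
    · simp only [dotProduct, Matrix.mulVec, KsY, Matrix.of_apply, Finset.mul_sum]
      exact Finset.sum_congr rfl fun i _ => Finset.sum_congr rfl fun j _ => by ring
  · simp only [dotProduct, Matrix.mulVec, gram, kc, Matrix.of_apply, Finset.mul_sum,
      Finset.sum_mul, Matrix.diagonal_apply, ite_mul, zero_mul, Finset.sum_ite_eq,
      Finset.mem_univ, if_true]
    rw [Finset.sum_comm]
    refine Finset.sum_congr rfl fun j _ => ?_
    rw [Finset.sum_comm]
    exact Finset.sum_congr rfl fun l _ => Finset.sum_congr rfl fun i _ => by ring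

theorem gram_isHermitian (hS : S.Standing) {D : Dataset n m} (hD : S.DataIn D) :
    (S.gram D).IsHermitian := by
  have hp : ∀ j, (D.get j).x ∈ S.X := fun j => hD _ (D.get_mem j)
  ext j l
  simp only [Matrix.conjTranspose_apply, star_trivial, gram, kc, Matrix.of_apply, dotProduct,
    Matrix.mulVec_diagonal]
  exact Finset.sum_congr rfl fun i _ => by rw [(hS.kernel i).symm (hp l) (hp j)]; ring

/-- The matrix `K_c + σ_n² I` is positive definite. -/
theorem gram_add_posDef (hS : S.Standing) {x : EuclideanSpace ℝ (Fin n)} (hx : x ∈ S.X)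
    {D : Dataset n m} (hD : S.DataIn D) :
    (S.gram D + S.σn ^ 2 • (1 : Matrix (Fin D.length) (Fin D.length) ℝ)).PosDef := by
  have hps : (S.gram D).PosSemidef :=
    .of_dotProduct_mulVec_nonneg (gram_isHermitian hS hD) fun b => by
      simpa using joint_nonneg hS hx hD 0 b
  exact Matrix.PosDef.posSemidef_add hps (Matrix.PosDef.one.smul (pow_pos hS.σn_pos 2))

/-- The posterior covariance `Σ_B(x | 𝔻)` is positive definite, as the Schur complement of
`K_c + σ_n² I` in the positive definite joint covariance of the unknown functions at `x` and of
the noisy measurements. -/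
theorem SigmaB_posDef (hS : S.Standing) {x : EuclideanSpace ℝ (Fin n)} (hx : x ∈ S.X)
    {D : Dataset n m} (hD : S.DataIn D) : (S.SigmaB x D).PosDef := by
  have hK := gram_add_posDef hS hx hD
  have hdiag : (Matrix.diagonal (fun i => S.k i x x)).PosDef :=
    Matrix.PosDef.diagonal fun i => (hS.kernel i).2 x hx
  set K := S.gram D + S.σn ^ 2 • (1 : Matrix (Fin D.length) (Fin D.length) ℝ) with hKdef
  set J := Matrix.fromBlocks (Matrix.diagonal (fun i => S.k i x x)) (S.KsY x D)
    (S.KsY x D)ᴴ K with hJ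
  have hquad : ∀ (a : Fin (m + 1) → ℝ) (b : Fin D.length → ℝ),
      Sum.elim a b ⬝ᵥ (J *ᵥ Sum.elim a b) =
        (a ⬝ᵥ (Matrix.diagonal (fun i => S.k i x x) *ᵥ a) + 2 * (a ⬝ᵥ (S.KsY x D *ᵥ b))
          + b ⬝ᵥ (S.gram D *ᵥ b)) + S.σn ^ 2 * (b ⬝ᵥ b) := by
    intro a b
    have hcomm : b ⬝ᵥ ((S.KsY x D)ᵀ *ᵥ a) = a ⬝ᵥ (S.KsY x D *ᵥ b) := by
      rw [Matrix.mulVec_transpose, Matrix.dotProduct_mulVec, dotProduct_comm]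
    simp only [hJ, Matrix.fromBlocks_mulVec, Sum.elim_comp_inl, Sum.elim_comp_inr,
      sumElim_dotProduct_sumElim, dotProduct_add, hKdef, Matrix.add_mulVec, Matrix.smul_mulVec,
      Matrix.one_mulVec, dotProduct_smul, smul_eq_mul,
      Matrix.conjTranspose_eq_transpose_of_trivial, hcomm]
    ring
  have hJpos : J.PosDef := by
    refine .of_dotProduct_mulVec_pos
      (Matrix.IsHermitian.fromBlocks hdiag.isHermitian rfl hK.isHermitian) fun v hv => ?_
    obtain ⟨a, b, rfl⟩ : ∃ a b, v = Sum.elim a b :=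
      ⟨v ∘ Sum.inl, v ∘ Sum.inr, (Sum.elim_comp_inl_inr v).symm⟩
    rw [star_trivial, hquad]
    by_cases hb : b = 0
    · subst hb
      have ha : a ≠ 0 := by
        rintro rfl
        exact hv (by ext i; cases i <;> rfl)
      simpa using hdiag.dotProduct_mulVec_pos ha
    · have h1 := joint_nonneg hS hx hD a b
      have h2 : 0 < b ⬝ᵥ b := by simpa using Matrix.dotProduct_star_self_pos_iff.2 hb
      have := mul_pos (pow_pos hS.σn_pos 2) h2
      linarith
  have : Invertible K := hK.isUnit.invertible
  have hSig : S.SigmaB x D =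
      Matrix.diagonal (fun i => S.k i x x) - S.KsY x D * K⁻¹ * (S.KsY x D)ᴴ := by
    rw [SigmaB, gramInv, Matrix.conjTranspose_eq_transpose_of_trivial]
  rw [hSig]
  refine (((Matrix.PosDef.fromBlocks₂₂ _ _ hK).1 hJpos.posSemidef).posDef_iff_det_ne_zero).2 ?_
  have hdet := hJpos.det_pos.ne'
  rw [hJ, Matrix.det_fromBlocks₂₂, Matrix.invOf_eq_nonsing_inv] at hdet
  exact right_ne_zero_of_mul hdet

/-! ### Lipschitz continuity of the safety filter -/

theorem aug_combination (u v : EuclideanSpace ℝ (Fin m)) {a b : ℝ} (hab : a + b = 1) :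
    aug (a • u + b • v) = a • aug u + b • aug v := by
  ext i
  refine Fin.cases ?_ (fun j => ?_) i
  · simp [aug, hab]
  · simp [aug]

theorem aug_ne_zero (u : EuclideanSpace ℝ (Fin m)) : aug u ≠ 0 := fun h => by
  simpa [aug] using congrFun h 0

theorem aug_contDiff (i : Fin (m + 1)) :
    ContDiff ℝ 2 (fun u : EuclideanSpace ℝ (Fin m) => aug u i) := by
  refine Fin.cases ?_ (fun j => ?_) i
  · simpa [aug] using contDiff_const
  · simp only [aug, Fin.cons_succ]
    fun_prop

/-- The vectors `[1, uᵀ]ᵀ` span. -/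
theorem exists_single_eq_aug (i : Fin (m + 1)) :
    ∃ (c c' : ℝ) (w w' : EuclideanSpace ℝ (Fin m)),
      (Pi.single i 1 : Fin (m + 1) → ℝ) = c • aug w + c' • aug w' := by
  refine Fin.cases ⟨1, 0, 0, 0, ?_⟩ (fun j => ⟨1, -1, EuclideanSpace.single j 1, 0, ?_⟩) i
  · ext l
    refine Fin.cases ?_ (fun l => ?_) l <;> simp [aug]
  · ext l
    refine Fin.cases ?_ (fun l => ?_) l
    · simp [aug]
    · simp [aug, Pi.single_apply]

theorem mB_contDiffOn (hC2 : S.TwiceContDiff) {D : Dataset n m} (hD : S.DataIn D)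
    (i : Fin (m + 1)) : ContDiffOn ℝ 2 (fun x => S.mB x D i) S.X := by
  obtain ⟨c, c', w, w', h⟩ := exists_single_eq_aug i
  refine ((contDiffOn_const (c := c)).mul (hC2.μB D hD w)).add
    ((contDiffOn_const (c := c')).mul (hC2.μB D hD w')) |>.congr fun x _ => ?_
  have : S.mB x D i = S.mB x D ⬝ᵥ Pi.single i 1 := by simp
  rw [this, h]
  simp [μB, dotProduct_add, dotProduct_smul]

/-- The entries of `Σ_B` are smooth because, by polarization, they are linear combinations of
values of the smooth functions `σ_B(·, u)²`. -/
theorem SigmaB_contDiffOn (hS : S.Standing) (hC2 : S.TwiceContDiff) {D : Dataset n m}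
    (hD : S.DataIn D) (i j : Fin (m + 1)) :
    ContDiffOn ℝ 2 (fun x => S.SigmaB x D i j) S.X := by
  have hq : ∀ u, ContDiffOn ℝ 2 (fun x => aug u ⬝ᵥ (S.SigmaB x D *ᵥ aug u)) S.X := fun u =>
    ((hC2.σB D hD u).pow 2).congr fun x hx =>
      (Real.sq_sqrt (by
        simpa using (SigmaB_posDef hS hx hD).posSemidef.dotProduct_mulVec_nonneg (aug u))).symm
  have hb : ∀ u v, ContDiffOn ℝ 2 (fun x => aug u ⬝ᵥ (S.SigmaB x D *ᵥ aug v)) S.X := by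
    intro u v
    refine (((contDiffOn_const (c := (2 : ℝ))).mul
      (hq ((1 / 2 : ℝ) • u + (1 / 2 : ℝ) • v))).sub
      ((contDiffOn_const (c := (1 / 2 : ℝ))).mul ((hq u).add (hq v)))).congr fun x hx => ?_
    have hsymm : aug v ⬝ᵥ (S.SigmaB x D *ᵥ aug u) = aug u ⬝ᵥ (S.SigmaB x D *ᵥ aug v) := by
      have hT : (S.SigmaB x D)ᵀ = S.SigmaB x D := (SigmaB_posDef hS hx hD).isHermitian
      rw [Matrix.dotProduct_mulVec, ← Matrix.mulVec_transpose, hT, dotProduct_comm]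
    rw [aug_combination u v (by norm_num)]
    simp only [Matrix.mulVec_add, Matrix.mulVec_smul, dotProduct_add, add_dotProduct,
      dotProduct_smul, smul_dotProduct, smul_eq_mul, hsymm]
    ring
  obtain ⟨c, c', w, w', h⟩ := exists_single_eq_aug i
  obtain ⟨d, d', z, z', h'⟩ := exists_single_eq_aug j
  refine (((contDiffOn_const (c := c * d)).mul (hb w z)).add
    ((contDiffOn_const (c := c * d')).mul (hb w z'))).add
    (((contDiffOn_const (c := c' * d)).mul (hb w' z)).add
    ((contDiffOn_const (c := c' * d')).mul (hb w' z'))) |>.congr fun x _ => ?_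
  have : S.SigmaB x D i j = Pi.single i 1 ⬝ᵥ (S.SigmaB x D *ᵥ Pi.single j 1) := by simp
  rw [this, h, h']
  simp only [Matrix.mulVec_add, Matrix.mulVec_smul, dotProduct_add, add_dotProduct,
    dotProduct_smul, smul_dotProduct, smul_eq_mul]
  ring

/-- The function of the state and the input that the chance constraint requires to be
nonnegative, for the dataset `D`. -/
noncomputable def constraint (S : LearningSetup n m) (D : Dataset n m)
    (x : EuclideanSpace ℝ (Fin n)) (u : EuclideanSpace ℝ (Fin m)) : ℝ :=
  S.LfNomB x + S.LgNomB x ⬝ᵥ u.ofLp + S.μB x u D - S.β D.length * S.σB x u D + S.γ (S.B x)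

/-- The constraint is jointly smooth in the state and the input: `σ_B` is the square root of a
quadratic polynomial in the input that is positive because `Σ_B` is positive definite. -/
theorem constraint_contDiffOn (hS : S.Standing) (hC2 : S.TwiceContDiff) {D : Dataset n m}
    (hD : S.DataIn D) :
    ContDiffOn ℝ 2 (fun p : EuclideanSpace ℝ (Fin n) × EuclideanSpace ℝ (Fin m) =>
      S.constraint D p.1 p.2) (S.X ×ˢ univ) := by
  have hx : ∀ {F : Type} [NormedAddCommGroup F] [NormedSpace ℝ F]
      {φ : EuclideanSpace ℝ (Fin n) → F}, ContDiffOn ℝ 2 φ S.X →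
      ContDiffOn ℝ 2 (fun p : EuclideanSpace ℝ (Fin n) × EuclideanSpace ℝ (Fin m) => φ p.1)
        (S.X ×ˢ univ) := fun hφ =>
    hφ.comp contDiff_fst.contDiffOn fun p hp => hp.1
  have hu : ∀ i, ContDiffOn ℝ 2
      (fun p : EuclideanSpace ℝ (Fin n) × EuclideanSpace ℝ (Fin m) => aug p.2 i)
      (S.X ×ˢ univ) := fun i => ((aug_contDiff i).comp contDiff_snd).contDiffOn
  unfold constraint μB σB
  refine ((((hx hC2.LfNomB).add ?_).add ?_).sub (contDiffOn_const.mul ?_)).add (hx hC2.γB)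
  · simp only [dotProduct]
    refine ContDiffOn.sum fun j _ => ContDiffOn.mul (hx ((contDiffOn_pi.1 hC2.LgNomB) j)) ?_
    exact (by fun_prop : ContDiff ℝ 2 fun p : EuclideanSpace ℝ (Fin n) ×
      EuclideanSpace ℝ (Fin m) => p.2.ofLp j).contDiffOn
  · simp only [dotProduct]
    exact ContDiffOn.sum fun i _ => (hx (mB_contDiffOn hC2 hD i)).mul (hu i)
  · refine ContDiffOn.sqrt ?_ fun p hp => ?_
    · simp only [dotProduct, Matrix.mulVec]
      exact ContDiffOn.sum fun i _ => (hu i).mul (ContDiffOn.sum fun j _ =>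
        (hx (SigmaB_contDiffOn hS hC2 hD i j)).mul (hu j))
    · have := (SigmaB_posDef hS hp.1 hD).dotProduct_mulVec_pos (aug_ne_zero p.2)
      rw [star_trivial] at this
      exact this.ne'

theorem constraint_concaveOn (hS : S.Standing) {D : Dataset n m} (hD : S.DataIn D)
    {x : EuclideanSpace ℝ (Fin n)} (hx : x ∈ S.X) : ConcaveOn ℝ univ (S.constraint D x) := by
  obtain ⟨N, hN⟩ := (SigmaB_posDef hS hx hD).posSemidef.exists_seminorm
  refine ⟨convex_univ, fun u _ v _ a b ha hb hab => ?_⟩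
  have h1 : S.σB x (a • u + b • v) D ≤ a * S.σB x u D + b * S.σB x v D := by
    unfold σB
    rw [← hN, ← hN, ← hN, aug_combination u v hab]
    refine (map_add_le_add N _ _).trans ?_
    rw [map_smul_eq_mul, map_smul_eq_mul, Real.norm_of_nonneg ha, Real.norm_of_nonneg hb]
  have h2 : S.μB x (a • u + b • v) D = a * S.μB x u D + b * S.μB x v D := by
    simp [μB, aug_combination u v hab, dotProduct_add, dotProduct_smul]
  have h3 : S.LgNomB x ⬝ᵥ (a • u + b • v).ofLp =
      a * (S.LgNomB x ⬝ᵥ u.ofLp) + b * (S.LgNomB x ⬝ᵥ v.ofLp) := by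
    simp [dotProduct_add, dotProduct_smul]
  have h4 := mul_le_mul_of_nonneg_left h1 (hS.β_pos D.length).le
  obtain rfl : b = 1 - a := by linarith
  simp only [constraint, smul_eq_mul, h2, h3]
  linarith

/-- If the tradeoff matrix is negative in a direction `v`, then Slater's condition holds: along `v`
or `-v`, the mean prediction of the constraint grows faster than `β` times the standard
deviation. -/
theorem exists_constraint_pos (hS : S.Standing) {D : Dataset n m} (hD : S.DataIn D)
    {x : EuclideanSpace ℝ (Fin n)} (hx : x ∈ S.X) {v : Fin m → ℝ}
    (hv : v ⬝ᵥ (S.tradeoff x D *ᵥ v) < 0) : ∃ u, 0 < S.constraint D x u := by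
  obtain ⟨N, hN⟩ := (SigmaB_posDef hS hx hD).posSemidef.exists_seminorm
  set β := S.β D.length with hβ
  have hβ0 : 0 < β := hS.β_pos _
  have hquad : v ⬝ᵥ (S.tradeoff x D *ᵥ v) =
      (β * N (Fin.cons 0 v)) ^ 2 - (S.LgHat x D ⬝ᵥ v) ^ 2 := by
    have h1 : v ⬝ᵥ (S.SigmaLgB x D *ᵥ v) = N (Fin.cons 0 v) ^ 2 := by
      rw [hN, Real.sq_sqrt (by
        simpa using (SigmaB_posDef hS hx hD).posSemidef.dotProduct_mulVec_nonneg (Fin.cons 0 v))]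
      simp [dotProduct, Matrix.mulVec, Fin.sum_univ_succ, SigmaLgB]
    have h2 : v ⬝ᵥ (Matrix.vecMulVec (S.LgHat x D) (S.LgHat x D) *ᵥ v) =
        (S.LgHat x D ⬝ᵥ v) ^ 2 := by
      rw [Matrix.vecMulVec_mulVec, sq]
      simp [dotProduct_comm v]
    rw [tradeoff, Matrix.sub_mulVec, dotProduct_sub, h2, Matrix.smul_mulVec, dotProduct_smul, h1,
      smul_eq_mul, mul_pow]
  have habs : β * N (Fin.cons 0 v) < |S.LgHat x D ⬝ᵥ v| := by
    rw [hquad] at hv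
    exact (le_abs_self _).trans_lt (sq_lt_sq.1 (sub_neg.1 hv))
  obtain ⟨w, hw⟩ : ∃ w : Fin m → ℝ, β * N (Fin.cons 0 w) < S.LgHat x D ⬝ᵥ w := by
    rcases le_or_gt 0 (S.LgHat x D ⬝ᵥ v) with h | h
    · exact ⟨v, by rwa [abs_of_nonneg h] at habs⟩
    · refine ⟨-v, ?_⟩
      have h1 : (Fin.cons 0 (-v) : Fin (m + 1) → ℝ) = -Fin.cons 0 v := by
        ext i
        refine Fin.cases ?_ (fun j => ?_) i <;> simp
      rw [h1, map_neg_eq_map, dotProduct_neg]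
      rwa [abs_of_neg h] at habs
  set c := S.LfNomB x + S.mB x D 0 + S.γ (S.B x) with hc
  set δ := S.LgHat x D ⬝ᵥ w - β * N (Fin.cons 0 w) with hδ
  have hδ0 : 0 < δ := sub_pos.2 hw
  have hlow : ∀ s : ℝ, 0 ≤ s →
      c + s * δ - β * N (aug 0) ≤ S.constraint D x (s • WithLp.toLp 2 w) := by
    intro s hs
    have h1 : aug (s • WithLp.toLp 2 w) = aug 0 + s • (Fin.cons 0 w : Fin (m + 1) → ℝ) := by
      ext i
      refine Fin.cases ?_ (fun j => ?_) i <;> simp [aug]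
    have h2 : S.σB x (s • WithLp.toLp 2 w) D ≤ N (aug 0) + s * N (Fin.cons 0 w) := by
      unfold σB
      rw [← hN, h1]
      refine (map_add_le_add N _ _).trans ?_
      rw [map_smul_eq_mul, Real.norm_of_nonneg hs]
    have h3 : S.LgNomB x ⬝ᵥ (s • WithLp.toLp 2 w).ofLp + S.μB x (s • WithLp.toLp 2 w) D =
        S.mB x D 0 + s * (S.LgHat x D ⬝ᵥ w) := by
      simp only [μB, dotProduct, Fin.sum_univ_succ, LgHat, aug, add_mul, Finset.sum_add_distrib,
        Finset.mul_sum, mul_add, Fin.cons_zero, Fin.cons_succ, WithLp.ofLp_smul, Pi.smul_apply,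
        smul_eq_mul, mul_one]
      have e : ∀ f : Fin m → ℝ, ∑ j, f j * (s * w j) = ∑ j, s * (f j * w j) := fun f =>
        Finset.sum_congr rfl fun j _ => by ring
      rw [e, e (fun j => S.mB x D j.succ)]
      ring
    have h4 := mul_le_mul_of_nonneg_left h2 hβ0.le
    unfold constraint
    rw [← hβ]
    have h5 : s * δ = s * (S.LgHat x D ⬝ᵥ w) - β * (s * N (Fin.cons 0 w)) := by
      rw [hδ]
      ring
    linarith
  refine ⟨_, (hlow ((|c| + β * N (aug 0) + 1) / δ) (by positivity)).trans_lt' ?_⟩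
  rw [div_mul_cancel₀ _ hδ0.ne']
  linarith [neg_abs_le c]

theorem tradeoff_isHermitian (hS : S.Standing) {D : Dataset n m} (hD : S.DataIn D)
    {x : EuclideanSpace ℝ (Fin n)} (hx : x ∈ S.X) : (S.tradeoff x D).IsHermitian := by
  have h : (S.SigmaB x D).IsHermitian := (SigmaB_posDef hS hx hD).isHermitian
  ext i j
  have := h.apply i.succ j.succ
  simp only [star_trivial] at this
  simp [tradeoff, SigmaLgB, Matrix.vecMulVec_apply, this, mul_comm]

theorem lamDag_lt_iff (hS : S.Standing) {D : Dataset n m} (hD : S.DataIn D)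
    {x : EuclideanSpace ℝ (Fin n)} (hx : x ∈ S.X) {a : ℝ} (ha : a ≤ 0) :
    S.lamDag x D < a ↔ ∃ v : Fin m → ℝ, v ⬝ᵥ (S.tradeoff x D *ᵥ v) < a * (v ⬝ᵥ v) :=
  (tradeoff_isHermitian hS hD hx).sInf_eigenvalues_lt_iff ha

theorem eventually_lamDag_lt (hS : S.Standing) (hC2 : S.TwiceContDiff) {D : Dataset n m}
    (hD : S.DataIn D) {x₀ : EuclideanSpace ℝ (Fin n)} (hx₀ : x₀ ∈ S.X)
    (h : S.lamDag x₀ D < -S.ε) : ∀ᶠ x in 𝓝 x₀, S.lamDag x D < -S.ε := by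
  have hε : -S.ε ≤ 0 := by linarith [hS.ε_pos]
  obtain ⟨v, hv⟩ := (lamDag_lt_iff hS hD hx₀ hε).1 h
  have hL : ∀ j, ContinuousOn (fun x => S.LgHat x D j) S.X := fun j =>
    ((contDiffOn_pi.1 hC2.LgNomB) j).continuousOn.add (mB_contDiffOn hC2 hD j.succ).continuousOn
  have hcont : ContinuousOn (fun x => v ⬝ᵥ (S.tradeoff x D *ᵥ v)) S.X := by
    simp only [dotProduct, Matrix.mulVec, tradeoff, Matrix.sub_apply, Matrix.smul_apply,
      Matrix.vecMulVec_apply, smul_eq_mul, SigmaLgB, Matrix.submatrix_apply]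
    exact continuousOn_finsetSum _ fun i _ => continuousOn_const.mul
      (continuousOn_finsetSum _ fun j _ => ((continuousOn_const.mul
        (SigmaB_contDiffOn hS hC2 hD i.succ j.succ).continuousOn).sub
        ((hL i).mul (hL j))).mul continuousOn_const)
  filter_upwards [hS.isOpen_X.mem_nhds hx₀,
    (hcont.continuousAt (hS.isOpen_X.mem_nhds hx₀)).eventually_lt_const hv] with x hx hxv
  exact (lamDag_lt_iff hS hD hx hε).2 ⟨v, hxv⟩

theorem exists_constraint_pos_of_lamDag_neg (hS : S.Standing) {D : Dataset n m}
    (hD : S.DataIn D) {x : EuclideanSpace ℝ (Fin n)} (hx : x ∈ S.X)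
    (h : S.lamDag x D < -S.ε) : ∃ u, 0 < S.constraint D x u := by
  obtain ⟨v, hv⟩ := (lamDag_lt_iff hS hD hx le_rfl).1
    (h.trans (neg_lt_zero.2 hS.ε_pos))
  exact exists_constraint_pos hS hD hx (by simpa using hv)

/-- Where `λ_†` lies below the threshold, the safety filter has a solution, so that `uStar` is not
its default value. -/
theorem isSOCPSolution_uStar (hS : S.Standing) (hC2 : S.TwiceContDiff) {D : Dataset n m}
    (hD : S.DataIn D) {x : EuclideanSpace ℝ (Fin n)} (hx : x ∈ S.X)
    (h : S.lamDag x D < -S.ε) : S.IsSOCPSolution x D (S.uStar x D) := by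
  have hex : ∃ u, S.IsSOCPSolution x D u := by
    obtain ⟨u₀, hu₀⟩ := exists_constraint_pos_of_lamDag_neg hS hD hx h
    have hcont : Continuous (S.constraint D x) := by
      have := (constraint_contDiffOn hS hC2 hD).continuousOn.comp
        (f := fun u : EuclideanSpace ℝ (Fin m) => (x, u)) (s := univ)
        (by fun_prop) (fun u _ => ⟨hx, mem_univ u⟩)
      exact continuousOn_univ.1 this
    have hclosed : IsClosed (S.feasibleSet x D) := isClosed_le continuous_const hcont
    obtain ⟨u, hu, hmin⟩ := hclosed.exists_infDist_eq_dist ⟨u₀, hu₀.le⟩ (S.uRef x)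
    refine ⟨u, hu, fun v hv => ?_⟩
    have h1 := Metric.infDist_le_dist_of_mem (x := S.uRef x) hv
    rw [hmin, dist_comm, dist_comm _ v, dist_eq_norm, dist_eq_norm] at h1
    exact pow_le_pow_left₀ (norm_nonneg _) h1 2
  rw [uStar, dif_pos hex]
  exact hex.choose_spec

theorem exists_lipschitzOnWith_uStar (hS : S.Standing) (hC2 : S.TwiceContDiff)
    {D : Dataset n m} (hD : S.DataIn D) {x₀ : EuclideanSpace ℝ (Fin n)} (hx₀ : x₀ ∈ S.X)
    (h : S.lamDag x₀ D < -S.ε) :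
    ∃ K : ℝ≥0, ∃ t ∈ 𝓝 x₀, LipschitzOnWith K (fun x => S.uStar x D) t := by
  obtain ⟨u₀, hu₀⟩ := exists_constraint_pos_of_lamDag_neg hS hD hx₀ h
  refine exists_lipschitzOnWith_of_isMinOn hS.isOpen_X (constraint_contDiffOn hS hC2 hD)
    (fun x hx => constraint_concaveOn hS hD hx) (hC2.uRef.of_le one_le_two) hx₀ hu₀ ?_
  filter_upwards [hS.isOpen_X.mem_nhds hx₀, eventually_lamDag_lt hS hC2 hD hx₀ h] with x hx hxl
  exact isSOCPSolution_uStar hS hC2 hD hx hxl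

/-- The closed-loop vector field for a fixed dataset is Lipschitz near each state at which
`λ_†` lies below the threshold. -/
theorem exists_lipschitzOnWith_closedLoop (hS : S.Standing) (hC2 : S.TwiceContDiff)
    {D : Dataset n m} (hD : S.DataIn D) {x₀ : EuclideanSpace ℝ (Fin n)} (hx₀ : x₀ ∈ S.X)
    (h : S.lamDag x₀ D < -S.ε) :
    ∃ K : ℝ≥0, ∃ t ∈ 𝓝 x₀, t ⊆ {x | x ∈ S.X ∧ S.lamDag x D < -S.ε} ∧
      LipschitzOnWith K (fun x => S.f x + S.g x (S.policy x D)) t := by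
  obtain ⟨Ku, tu, htu, hu⟩ := exists_lipschitzOnWith_uStar hS hC2 hD hx₀ h
  obtain ⟨Kf, tf, htf, hf⟩ := hS.lip_f hx₀
  obtain ⟨Kg, tg, htg, hg⟩ := hS.lip_g hx₀
  rw [hS.isOpen_X.nhdsWithin_eq hx₀] at htf htg
  have hev : ∀ᶠ x in 𝓝 x₀, ((x ∈ tu ∧ x ∈ tf) ∧ x ∈ tg) ∧ x ∈ S.X ∧ S.lamDag x D < -S.ε :=
    (((eventually_mem_set.2 htu).and (eventually_mem_set.2 htf)).and
      (eventually_mem_set.2 htg)).and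
      ((hS.isOpen_X.eventually_mem hx₀).and (eventually_lamDag_lt hS hC2 hD hx₀ h))
  obtain ⟨δ, hδ, hball⟩ := Metric.nhds_basis_closedBall.eventually_iff.1 hev
  have h0 := Metric.mem_closedBall_self (x := x₀) hδ.le
  set Mu : ℝ := ‖S.uStar x₀ D‖ + Ku * δ with hMu
  set Mg : ℝ := ‖S.g x₀‖ + Kg * δ with hMg
  have hMg0 : 0 ≤ Mg := by positivity
  have hMu0 : 0 ≤ Mu := by positivity
  have hub : ∀ x ∈ Metric.closedBall x₀ δ, ‖S.uStar x D‖ ≤ Mu := by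
    intro x hx
    have h1 := hu.norm_sub_le (hball hx).1.1.1 (hball h0).1.1.1
    have h2 : ‖x - x₀‖ ≤ δ := by rwa [← mem_closedBall_iff_norm]
    have h3 := norm_le_norm_sub_add (S.uStar x D) (S.uStar x₀ D)
    have h4 : (Ku : ℝ) * ‖x - x₀‖ ≤ Ku * δ := by gcongr
    linarith
  have hgb : ∀ x ∈ Metric.closedBall x₀ δ, ‖S.g x‖ ≤ Mg := by
    intro x hx
    have h1 := hg.norm_sub_le (hball hx).1.2 (hball h0).1.2
    have h2 : ‖x - x₀‖ ≤ δ := by rwa [← mem_closedBall_iff_norm]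
    have h3 := norm_le_norm_sub_add (S.g x) (S.g x₀)
    have h4 : (Kg : ℝ) * ‖x - x₀‖ ≤ Kg * δ := by gcongr
    linarith
  refine ⟨⟨Kf + (Kg * Mu + Mg * Ku), by positivity⟩, _, Metric.closedBall_mem_nhds _ hδ,
    fun x hx => (hball hx).2, LipschitzOnWith.of_dist_le_mul fun x hx y hy => ?_⟩
  have hpol : ∀ z ∈ Metric.closedBall x₀ δ, S.policy z D = S.uStar z D := fun z hz =>
    if_pos (hball hz).2.2
  rw [dist_eq_norm, dist_eq_norm, hpol x hx, hpol y hy]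
  have e : S.f x + S.g x (S.uStar x D) - (S.f y + S.g y (S.uStar y D)) =
      (S.f x - S.f y) + ((S.g x - S.g y) (S.uStar x D) +
        S.g y (S.uStar x D - S.uStar y D)) := by
    rw [sub_apply, map_sub]
    abel
  have h1 := hf.norm_sub_le (hball hx).1.1.2 (hball hy).1.1.2
  have h2 : ‖(S.g x - S.g y) (S.uStar x D)‖ ≤ Kg * ‖x - y‖ * Mu :=
    ((S.g x - S.g y).le_opNorm _).trans (mul_le_mul
      (hg.norm_sub_le (hball hx).1.2 (hball hy).1.2) (hub x hx) (norm_nonneg _) (by positivity))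
  have h3 : ‖S.g y (S.uStar x D - S.uStar y D)‖ ≤ Mg * (Ku * ‖x - y‖) :=
    ((S.g y).le_opNorm _).trans (mul_le_mul (hgb y hy)
      (hu.norm_sub_le (hball hx).1.1.1 (hball hy).1.1.1) (norm_nonneg _) hMg0)
  rw [e]
  refine (norm_add_le_of_le h1 (norm_add_le_of_le h2 h3)).trans_eq ?_
  change _ = (Kf + (Kg * Mu + Mg * Ku)) * ‖x - y‖
  ring

end LearningSetup

/-! ### Induction along a real interval -/

/-- Induction along a real interval: a property that passes to the right end of each interval
`[0, t)` and persists for a while after each time holds throughout. -/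
theorem forall_mem_Ico_of_step {T : ℝ} {Q : ℝ → Prop}
    (hleft : ∀ t ∈ Ico 0 T, (∀ s ∈ Ico 0 t, Q s) → Q t)
    (hright : ∀ t ∈ Ico 0 T, Q t → ∀ᶠ s in 𝓝[>] t, Q s) : ∀ t ∈ Ico 0 T, Q t := by
  by_contra! hbad
  set Bad : Set ℝ := {t | t ∈ Ico 0 T ∧ ¬ Q t} with hBad
  have hne : Bad.Nonempty := hbad
  have hbdd : BddBelow Bad := ⟨0, fun t ht => ht.1.1⟩
  have h0 : 0 ≤ sInf Bad := le_csInf hne fun t ht => ht.1.1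
  have hT : sInf Bad < T := by
    obtain ⟨t, ht⟩ := hne
    exact (csInf_le hbdd ht).trans_lt ht.1.2
  have hQ : Q (sInf Bad) := hleft _ ⟨h0, hT⟩ fun s hs => by
    by_contra hns
    exact notMem_of_lt_csInf hs.2 hbdd ⟨⟨hs.1, hs.2.trans hT⟩, hns⟩
  obtain ⟨b, hb, hsub⟩ := (mem_nhdsGT_iff_exists_Ioo_subset).1 (hright _ ⟨h0, hT⟩ hQ)
  obtain ⟨t, ht, htb⟩ := exists_lt_of_csInf_lt hne hb
  rcases (csInf_le hbdd ht).lt_or_eq with h | h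
  · exact ht.2 (hsub ⟨h, htb⟩)
  · exact ht.2 (h ▸ hQ)

namespace LearningSetup

variable {n m : ℕ} {S : LearningSetup n m}

/-! ### Executions -/

theorem LoopEndsWith.unique {t : ℝ} {x : EuclideanSpace ℝ (Fin n)} {D D₁ D₂ : Dataset n m}
    (h₁ : S.LoopEndsWith t x D D₁) (h₂ : S.LoopEndsWith t x D D₂) : D₁ = D₂ := by
  obtain ⟨j, hj, rfl, hjl, hji⟩ := h₁
  obtain ⟨l, hl, rfl, hll, hli⟩ := h₂
  rcases lt_trichotomy j l with h | h | h
  · exact absurd (hli j h hj) hjl.not_ge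
  · rw [h]
  · exact absurd (hji l h hl) hll.not_ge

theorem LoopEndsWith.lamDag_lt {t : ℝ} {x : EuclideanSpace ℝ (Fin n)} {D D' : Dataset n m}
    (h : S.LoopEndsWith t x D D') : S.lamDag x D' < -S.ε :=
  let ⟨_, _, _, h, _⟩ := h
  h

theorem LoopEndsWith.dataIn {t : ℝ} {x : EuclideanSpace ℝ (Fin n)} {D D' : Dataset n m}
    (h : S.LoopEndsWith t x D D') (hx : x ∈ S.X) (hD : S.DataIn D) : S.DataIn D' := by
  obtain ⟨j, -, rfl, -, -⟩ := h
  clear * - hx hD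
  induction j with
  | zero => exact hD
  | succ j ih =>
    rw [Function.iterate_succ_apply']
    intro p hp
    rcases List.mem_append.1 hp with hp | hp
    · exact ih p hp
    · rw [List.mem_singleton.1 hp]
      exact hx

theorem IsExecution.dataIn {x₀ : EuclideanSpace ℝ (Fin n)} {D₀ : Dataset n m} {T : ℝ}
    {x : ℝ → EuclideanSpace ℝ (Fin n)} {D : ℝ → Dataset n m}
    (h : S.IsExecution x₀ D₀ T x D) (hD₀ : S.DataIn D₀) : ∀ t ∈ Ico 0 T, S.DataIn (D t) := by
  refine forall_mem_Ico_of_step (fun t ht hQ => ?_) fun t ht hQ => ?_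
  · obtain ⟨Dpre, hpre, hloop⟩ := h.data_update t ht
    refine hloop.dataIn (h.mem t ht) ?_
    rcases hpre with ⟨-, rfl⟩ | ⟨ht0, hev⟩
    · exact hD₀
    · obtain ⟨s, hs, hs'⟩ := (hev.and (Ioo_mem_nhdsLT ht0)).exists
      exact hs ▸ hQ s ⟨hs'.1.le, hs'.2⟩
  · filter_upwards [h.data_const t ht] with s hs
    rwa [hs]

/-- Two executions that agree before the time `t` agree at `t`: the states by continuity, the
datasets because the updates at one instant are determined by the state and the dataset just
before. -/
theorem IsExecution.eq_of_eqOn_Ico {x₀ : EuclideanSpace ℝ (Fin n)} {D₀ : Dataset n m} {T : ℝ}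
    {x x' : ℝ → EuclideanSpace ℝ (Fin n)} {D D' : ℝ → Dataset n m}
    (h : S.IsExecution x₀ D₀ T x D) (h' : S.IsExecution x₀ D₀ T x' D') {t : ℝ}
    (ht : t ∈ Ico 0 T) (hQ : ∀ s ∈ Ico 0 t, x s = x' s ∧ D s = D' s) :
    x t = x' t ∧ D t = D' t := by
  obtain ⟨Dpre, hpre, hloop⟩ := h.data_update t ht
  obtain ⟨Dpre', hpre', hloop'⟩ := h'.data_update t ht
  suffices hx : x t = x' t ∧ Dpre = Dpre' by
    obtain ⟨hx, rfl⟩ := hx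
    exact ⟨hx, LoopEndsWith.unique hloop (hx ▸ hloop')⟩
  rcases ht.1.lt_or_eq with ht0 | rfl
  · have hev : ∀ᶠ s in 𝓝[<] t, s ∈ Ioo 0 t := Ioo_mem_nhdsLT ht0
    have hle : 𝓝[<] t ≤ 𝓝[Ico 0 T] t := by
      rw [← nhdsWithin_Ioo_eq_nhdsLT ht0]
      exact nhdsWithin_mono _ fun s hs => ⟨hs.1.le, hs.2.trans ht.2⟩
    constructor
    · exact tendsto_nhds_unique_of_eventuallyEq ((h.cont t ht).mono_left hle)
        ((h'.cont t ht).mono_left hle) (hev.mono fun s hs => (hQ s ⟨hs.1.le, hs.2⟩).1)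
    · rcases hpre with ⟨h0, -⟩ | ⟨-, hp⟩
      · exact absurd h0 ht0.ne'
      rcases hpre' with ⟨h0, -⟩ | ⟨-, hp'⟩
      · exact absurd h0 ht0.ne'
      obtain ⟨s, ⟨hs, hs'⟩, hs''⟩ := ((hp.and hp').and hev).exists
      rw [← hs, ← hs']
      exact (hQ s ⟨hs''.1.le, hs''.2⟩).2
  · refine ⟨h.init.trans h'.init.symm, ?_⟩
    rcases hpre with ⟨-, rfl⟩ | ⟨h0, -⟩
    · rcases hpre' with ⟨-, rfl⟩ | ⟨h0, -⟩
      · rfl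
      · exact absurd h0 (lt_irrefl 0)
    · exact absurd h0 (lt_irrefl 0)

/-- Two executions that agree at the time `t` agree for a while afterwards: both datasets are
constant there, and both states solve the same differential equation with a Lipschitz
right-hand side. -/
theorem IsExecution.eventually_eq {x₀ : EuclideanSpace ℝ (Fin n)} {D₀ : Dataset n m} {T : ℝ}
    {x x' : ℝ → EuclideanSpace ℝ (Fin n)} {D D' : ℝ → Dataset n m}
    (hS : S.Standing) (hC2 : S.TwiceContDiff) (hD₀ : S.DataIn D₀)
    (h : S.IsExecution x₀ D₀ T x D) (h' : S.IsExecution x₀ D₀ T x' D') {t : ℝ}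
    (ht : t ∈ Ico 0 T) (hxt : x t = x' t) (hDt : D t = D' t) :
    ∀ᶠ s in 𝓝[>] t, x s = x' s ∧ D s = D' s := by
  obtain ⟨Dpre, -, hloop⟩ := h.data_update t ht
  obtain ⟨K, N, hN, -, hK⟩ := exists_lipschitzOnWith_closedLoop hS hC2 (h.dataIn hD₀ t ht)
    (h.mem t ht) hloop.lamDag_lt
  have hle : 𝓝[>] t ≤ 𝓝[Ico 0 T] t := by
    rw [← nhdsWithin_Ioo_eq_nhdsGT ht.2]
    exact nhdsWithin_mono _ fun s hs => ⟨ht.1.trans hs.1.le, hs.2⟩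
  have hxN : ∀ᶠ s in 𝓝[>] t, x s ∈ N := ((h.cont t ht).mono_left hle) hN
  have hxN' : ∀ᶠ s in 𝓝[>] t, x' s ∈ N := ((h'.cont t ht).mono_left hle) (hxt ▸ hN)
  have hDs := h.data_const t ht
  have hDs' := h'.data_const t ht
  rw [← hDt] at hDs'
  obtain ⟨b, hb, hsub⟩ := (mem_nhdsGT_iff_exists_Ioo_subset).1
    ((hxN.and hxN').and (hDs.and (hDs'.and (Ioo_mem_nhdsGT ht.2))))
  filter_upwards [Ioo_mem_nhdsGT hb] with s hs
  have hall : ∀ r ∈ Icc t s, (x r ∈ N ∧ x' r ∈ N) ∧ D r = D t ∧ D' r = D t ∧ r ∈ Ico 0 T := by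
    intro r hr
    rcases hr.1.lt_or_eq with h1 | rfl
    · obtain ⟨h2, h3, h4, h5⟩ := hsub ⟨h1, hr.2.trans_lt hs.2⟩
      exact ⟨h2, h3, h4, ht.1.trans h1.le, h5.2⟩
    · exact ⟨⟨mem_of_mem_nhds hN, hxt ▸ mem_of_mem_nhds hN⟩, rfl, hDt.symm, ht⟩
  have heq : EqOn x x' (Icc t s) := by
    refine ODE_solution_unique_of_mem_Icc_right
      (v := fun _ y => S.f y + S.g y (S.policy y (D t))) (s := fun _ => N) (K := K)
      (fun _ _ => hK) (h.cont.mono fun r hr => (hall r hr).2.2.2) (fun r hr => ?_)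
      (fun r hr => (hall r (Ico_subset_Icc_self hr)).1.1)
      (h'.cont.mono fun r hr => (hall r hr).2.2.2) (fun r hr => ?_)
      (fun r hr => (hall r (Ico_subset_Icc_self hr)).1.2) hxt
    · obtain ⟨-, h2, -, h4⟩ := hall r (Ico_subset_Icc_self hr)
      rw [← h2]
      exact h.plant r h4
    · obtain ⟨-, -, h3, h4⟩ := hall r (Ico_subset_Icc_self hr)
      rw [← h3]
      exact h'.plant r h4
  obtain ⟨-, h2, h3, -⟩ := hall s (right_mem_Icc.2 hs.1.le)
  exact ⟨heq (right_mem_Icc.2 hs.1.le), h2.trans h3.symm⟩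

theorem IsExecution.unique {x₀ : EuclideanSpace ℝ (Fin n)} {D₀ : Dataset n m} {T : ℝ}
    {x x' : ℝ → EuclideanSpace ℝ (Fin n)} {D D' : ℝ → Dataset n m}
    (hS : S.Standing) (hC2 : S.TwiceContDiff) (hD₀ : S.DataIn D₀)
    (h : S.IsExecution x₀ D₀ T x D) (h' : S.IsExecution x₀ D₀ T x' D') :
    ∀ t ∈ Ico 0 T, x t = x' t ∧ D t = D' t :=
  forall_mem_Ico_of_step (fun _ ht hQ => h.eq_of_eqOn_Ico h' ht hQ)
    fun _ ht hQ => h.eventually_eq hS hC2 hD₀ h' ht hQ.1 hQ.2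

/-- A solution exists for a time that is so short that it contains no further periodic measurement
and `λ_†` stays below the threshold; the dataset remains the one with which the initial updates
end. -/
theorem exists_isExecution (hS : S.Standing) (hC2 : S.TwiceContDiff)
    {x₀ : EuclideanSpace ℝ (Fin n)} (hx₀ : x₀ ∈ S.X) {D₀ D₁ : Dataset n m}
    (hD₀ : S.DataIn D₀) (hloop : S.LoopEndsWith 0 x₀ D₀ D₁) :
    ∃ T : ℝ, 0 < T ∧ ∃ x D, S.IsExecution x₀ D₀ T x D := by
  obtain ⟨K, N, hN, hNsub, hK⟩ := exists_lipschitzOnWith_closedLoop hS hC2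
    (hloop.dataIn hx₀ hD₀) hx₀ hloop.lamDag_lt
  set F : EuclideanSpace ℝ (Fin n) → EuclideanSpace ℝ (Fin n) :=
    fun y => S.f y + S.g y (S.policy y D₁) with hF
  obtain ⟨δ, hδ, hball⟩ := Metric.nhds_basis_closedBall.mem_iff.1 hN
  lift δ to ℝ≥0 using hδ.le
  set L : ℝ≥0 := ‖F x₀‖₊ + K * δ + 1 with hL
  have hL0 : 0 < L := by positivity
  have hbound : ∀ y ∈ Metric.closedBall x₀ (δ : ℝ), ‖F y‖ ≤ L := by
    intro y hy
    have h1 := hK.norm_sub_le (hball hy) (mem_of_mem_nhds hN)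
    have h2 : ‖y - x₀‖ ≤ δ := by rwa [← mem_closedBall_iff_norm]
    have h3 : ‖F y‖ ≤ ‖F y - F x₀‖ + ‖F x₀‖ := norm_le_norm_sub_add _ _
    have h4 : (K : ℝ) * ‖y - x₀‖ ≤ K * δ := by gcongr
    rw [hL]
    push_cast
    linarith
  set η : ℝ := δ / L with hη
  have hη0 : 0 < η := div_pos hδ (by exact_mod_cast hL0)
  have hPL : IsPicardLindelof (fun _ => F) (tmin := 0) (tmax := η)
      ⟨0, left_mem_Icc.2 hη0.le⟩ x₀ δ 0 L K := by
    refine .of_time_independent hbound (hK.mono hball) ?_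
    have : (L : ℝ) ≠ 0 := by exact_mod_cast hL0.ne'
    simp only [sub_zero, sub_self, NNReal.coe_zero]
    rw [max_eq_left hη0.le, hη, mul_div_cancel₀ _ this]
  obtain ⟨φ, hφ0, hφ⟩ := hPL.exists_eq_forall_mem_Icc_hasDerivWithinAt₀
  have hφc : ContinuousOn φ (Icc 0 η) := fun t ht => (hφ t ht).continuousWithinAt
  have hev : ∀ᶠ t in 𝓝[≥] (0 : ℝ), φ t ∈ N := by
    have h1 : Tendsto φ (𝓝[Icc 0 η] 0) (𝓝 x₀) := by
      have := hφc 0 (left_mem_Icc.2 hη0.le)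
      rwa [ContinuousWithinAt, hφ0] at this
    rw [nhdsWithin_Icc_eq_nhdsGE hη0] at h1
    exact h1 hN
  obtain ⟨b, hb, hbN⟩ := (mem_nhdsGE_iff_exists_Ico_subset).1 hev
  have hb0 : 0 < b := hb
  refine ⟨min b (min η S.τ), lt_min hb0 (lt_min hη0 hS.τ_pos), φ, fun _ => D₁, ?_⟩
  have hlt : ∀ t ∈ Ico 0 (min b (min η S.τ)), φ t ∈ N ∧ t ∈ Ico 0 η ∧ t < S.τ := by
    intro t ht
    obtain ⟨h1, h2, h3⟩ : t < b ∧ t < η ∧ t < S.τ := by simpa using ht.2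
    exact ⟨hbN ⟨ht.1, h1⟩, ⟨ht.1, h2⟩, h3⟩
  refine ⟨hφ0, fun t ht => (hNsub (hlt t ht).1).1,
    hφc.mono fun t ht => Ico_subset_Icc_self (hlt t ht).2.1, fun t ht => ?_,
    fun t _ => Eventually.of_forall fun _ => rfl, fun t ht => ?_⟩
  · rcases ht.1.lt_or_eq with h0 | rfl
    · refine ⟨D₁, Or.inr ⟨h0, Eventually.of_forall fun _ => rfl⟩, 0, fun htr => ?_, rfl,
        (hNsub (hlt t ht).1).2, fun i hi => absurd hi (Nat.not_lt_zero i)⟩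
      obtain ⟨k, rfl⟩ := htr
      have hk : (k : ℝ) < 1 := by
        have := (hlt _ ht).2.2
        exact lt_of_mul_lt_mul_right (by rwa [one_mul]) hS.τ_pos.le
      have hk0 : k = 0 := by
        have : k < 1 := by exact_mod_cast hk
        omega
      rw [hk0] at h0
      simp at h0
    · exact ⟨D₀, Or.inl ⟨rfl, rfl⟩, by rwa [show φ 0 = x₀ from hφ0]⟩
  · have h1 := (hlt t ht).2.1
    exact (hφ t (Ico_subset_Icc_self h1)).mono_of_mem_nhdsWithin
      (mem_of_superset (Icc_mem_nhdsGE h1.2) (Icc_subset_Icc_left h1.1))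

end LearningSetup

theorem mainTheorem5 {n m : ℕ} (S : LearningSetup n m)
    (hS : S.Standing)
    (hC2 : S.TwiceContDiff)
    (hrel : ∀ x ∈ S.X, S.LgB x ≠ 0)
    (x₀ : EuclideanSpace ℝ (Fin n)) (hx₀ : x₀ ∈ S.X)
    (D₀ : Dataset n m) (hD₀ : S.DataIn D₀)
    (hlam : S.lamDag x₀ D₀ < 0)
    (hpred : S.PredictedRelDegreeOne x₀ D₀)
    (htrig : S.TriggeringCondition x₀ D₀)
    -- only finitely many measurements are taken at the initial instant
    (hdisc : ∃ D₁, S.LoopEndsWith 0 x₀ D₀ D₁) :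
    ∃ τmax : ℝ, 0 < τmax ∧
      (∃ x D, S.IsExecution x₀ D₀ τmax x D) ∧
      ∀ (T : ℝ) (x x' : ℝ → EuclideanSpace ℝ (Fin n)) (D D' : ℝ → Dataset n m),
        S.IsExecution x₀ D₀ T x D → S.IsExecution x₀ D₀ T x' D' →
        ∀ t ∈ Set.Ico 0 T, x t = x' t ∧ D t = D' t := by
  obtain ⟨D₁, hD₁⟩ := hdisc
  obtain ⟨T, hT, hex⟩ := LearningSetup.exists_isExecution hS hC2 hx₀ hD₀ hD₁
  exact ⟨T, hT, hex, fun _ _ _ _ _ h h' => h.unique hS hC2 hD₀ h'⟩
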